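/- Let $\Sigma$ be a smooth complete fan in $N_{\mathbb R}$, where $N\cong\mathbb Z^d$ has dual lattice $M$, and for each ray $\rho\in\Sigma(1)$ let $\mathbf v_\rho\in N$ be its primitive generator. Let $\mathcal M$ be a loop-free matroid on a nonempty finite ground set, also denoted $\mathcal M$. Let $\mathrm{Berg}(\mathcal M)\subseteq\mathbb R^{\mathcal M}$ be the set of all $w$ such that $\min_{i\in C}w_i$ is attained at least twice for every circuit $C$. For a basis $B$ let $\delta_B\in\mathbb R^{\mathcal M}$ be its indicator vector, and let the apartment $A_B$ be the intersection of $\mathrm{Berg}(\mathcal M)$ with the outer normal cone at $\delta_B$ of the matroid polytope $\mathrm{conv}\{\delta_{B'}\mid B'\text{ a basis}\}$. Let $\mathcal F(\Sigma,\mathcal M)$ be the set of real matrices $D=(D_{\rho,e})_{\rho\in\Sigma(1),\,e\in\mathcal M}$ whose rows lie in $\mathrm{Berg}(\mathcal M)$ and such that for each $\sigma\in\Sigma$ there is a basis $B$ for which the rows of all rays of $\sigma$ lie in $A_B$. For such $D$, $e\in\mathcal M$ and $F\subseteq\mathcal M$ put $P_{D,e}=\{u\in M_{\mathbb R}\mid\langle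 u,\mathbf v_\rho\rangle\le D_{\rho,e}\text{ for all }\rho\in\Sigma(1)\}$ and $P_{D,F}=\bigcap_{e\in F}P_{D,e}$. Let $\mathcal F^+(\Sigma,\mathcal M)$ be the set of those $D\in\mathcal F(\Sigma,\mathcal M)$ for which $P_{D,F}$ has outer normal fan $\Sigma$ for every nonempty flat $F$ of $\mathcal M$. For $u\in M_{\mathbb R}$ let $$h^0_D(u)=\operatorname{rank}\bigcap_{\rho\in\Sigma(1)}\{e\in\mathcal M\mid D_{\rho,e}\ge\langle u,\mathbf v_\rho\rangle\}.$$ Then for every $D\in\mathcal F^+(\Sigma,\mathcal M)$ only finitely many $u\in M$ satisfy $h^0_D(u)\neq0$, and the function $$\mathfrak h_{\Sigma,\mathcal M}(D)=\sum_{u\in M}h^0_D(u)$$ on the integral matrices in $\mathcal F^+(\Sigma,\mathcal M)$ is piecewise polynomial of degree $d=\dim X_\Sigma$ in the entries of $D$: the space $\mathbb R^{\Sigma(1)\times\mathcal M}$ is a union of finitely many rational polyhedral cones, and for each of these cones there is a polynomial with rational coefficients, of total degree exactly $d$ in the entries of $D$, that equals $\mathfrak h_{\Sigma,\mathcal M}(D)$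 for all integral $D\in\mathcal F^+(\Sigma,\mathcal M)$ in that cone. -/

import Mathlib

open scoped Matrix

namespace TropBundle

/-! Lattices are `N = ℤᵈ` and `M = ℤᵈ`, paired by the dot product; `N_ℝ` and `M_ℝ` are `ℝᵈ`. -/

/-- The inclusion `ℤᵈ ⊆ ℝᵈ`. -/
def toReal {ι : Type*} (v : ι → ℤ) : ι → ℝ := fun i => (v i : ℝ)

/-- A (finite, rational, polyhedral) fan in `ℝᵈ`: a nonempty finite collection of strongly convex
rational polyhedral cones, closed under taking faces, in which any two cones meet in a common
face. -/
structure Fan (d : ℕ) where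
  cones : Set (PointedCone ℝ (Fin d → ℝ))
  nonempty : cones.Nonempty
  finite : cones.Finite
  rational : ∀ σ ∈ cones, ∃ G : Finset (Fin d → ℤ),
    σ = PointedCone.hull ℝ (toReal '' (G : Set (Fin d → ℤ)))
  stronglyConvex : ∀ σ ∈ cones, ∀ x ∈ σ, -x ∈ σ → x = 0
  face_mem : ∀ σ ∈ cones, ∀ τ : PointedCone ℝ (Fin d → ℝ), τ.IsFaceOf σ → τ ∈ cones
  inter_isFace : ∀ σ ∈ cones, ∀ τ ∈ cones, (σ ⊓ τ).IsFaceOf σ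

namespace Fan

variable {d : ℕ} (Δ : Fan d)

/-- The fan is complete: its support is all of `ℝᵈ`. -/
def IsComplete : Prop := ∀ x : Fin d → ℝ, ∃ σ ∈ Δ.cones, x ∈ σ

/-- The fan is smooth: each cone is generated by part of a `ℤ`-basis of the lattice. -/
def IsSmooth : Prop :=
  ∀ σ ∈ Δ.cones, ∃ (b : Module.Basis (Fin d) ℤ (Fin d → ℤ)) (s : Set (Fin d)),
    σ = PointedCone.hull ℝ ((fun i => toReal (b i)) '' s)

/-- The rays of the fan, each given by its primitive generator `v_ρ`: the lattice vectors with
coprime coordinates that span a cone of the fan. -/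
def rays : Set (Fin d → ℤ) :=
  {v | Finset.univ.gcd v = 1 ∧ PointedCone.hull ℝ {toReal v} ∈ Δ.cones}

end Fan

section Normal

variable {ι : Type*} [Fintype ι]

/-- The outer normal cone at a point `y` of a set `P`: the linear functionals whose maximum over
`P` is attained at `y`. -/
def normalCone (P : Set (ι → ℝ)) (y : ι → ℝ) : Set (ι → ℝ) :=
  {w | ∀ z ∈ P, z ⬝ᵥ w ≤ y ⬝ᵥ w}

/-- `P` has outer normal fan `Δ`. The normal cone of a face of a polyhedron `P` is the normal cone
at any point of the relative interior of the face, and each point of `P` is in the relative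
interior of exactly one face, so the normal fan consists of the normal cones at the points of
`P`. -/
def HasNormalFan {d : ℕ} (P : Set (Fin d → ℝ)) (Δ : Fan d) : Prop :=
  normalCone P '' P = (fun σ : PointedCone ℝ (Fin d → ℝ) => (σ : Set (Fin d → ℝ))) '' Δ.cones

end Normal

section MatroidPart

variable {α : Type*}

/-- The support of the Bergman fan (minimum convention): the vectors whose minimum over each
circuit is attained at least twice. -/
def bergman (M : Matroid α) : Set (α → ℝ) :=
  {w | ∀ C, M.IsCircuit C → ∃ i ∈ C, ∃ j ∈ C, i ≠ j ∧ ∀ k ∈ C, w i ≤ w k ∧ w j ≤ w k}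

/-- The indicator vector `δ_J`. -/
noncomputable def delta (J : Set α) : α → ℝ := J.indicator 1

/-- The matroid polytope: the convex hull of the indicator vectors of the bases. -/
def matroidPolytope (M : Matroid α) : Set (α → ℝ) :=
  convexHull ℝ {x | ∃ B, M.IsBase B ∧ x = delta B}

/-- The apartment `A_B`: the intersection of the Bergman fan with the maximal cone corresponding
to the basis `B` in the outer normal fan of the matroid polytope. -/
def apartment [Fintype α] (M : Matroid α) (B : Set α) : Set (α → ℝ) :=
  bergman M ∩ normalCone (matroidPolytope M) (delta B)

end MatroidPart

section Diagrams

variable {d : ℕ} {Δ : Fan d} {α : Type*}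

/-- The real matrices that satisfy the tropical condition (rows in the Bergman fan) and the
apartment condition (for each cone the rows of its rays lie in a common apartment). -/
def diagrams [Fintype α] (Δ : Fan d) (M : Matroid α) : Set (Matrix Δ.rays α ℝ) :=
  {D | (∀ ρ, D ρ ∈ bergman M) ∧
    ∀ σ ∈ Δ.cones, ∃ B, M.IsBase B ∧
      ∀ ρ : Δ.rays, toReal (ρ : Fin d → ℤ) ∈ σ → D ρ ∈ apartment M B}

/-- `P_{D,e} = {u | ⟨u, v_ρ⟩ ≤ D_{ρ,e} for all rays ρ}`. -/
def polyhedron (D : Matrix Δ.rays α ℝ) (e : α) : Set (Fin d → ℝ) :=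
  {u | ∀ ρ : Δ.rays, u ⬝ᵥ toReal (ρ : Fin d → ℤ) ≤ D ρ e}

/-- `P_{D,F}`: the intersection of the polyhedra `P_{D,e}` over `e ∈ F`. -/
def flatPolyhedron (D : Matrix Δ.rays α ℝ) (F : Set α) : Set (Fin d → ℝ) :=
  ⋂ e ∈ F, polyhedron D e

/-- The diagrams for which `P_{D,F}` has outer normal fan `Δ` for each nonempty flat `F`. -/
def ampleDiagrams [Fintype α] (Δ : Fan d) (M : Matroid α) : Set (Matrix Δ.rays α ℝ) :=
  {D | D ∈ diagrams Δ M ∧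
    ∀ F, M.IsFlat F → F.Nonempty → HasNormalFan (flatPolyhedron D F) Δ}

/-- The Klyachko filtration of the ray `ρ`: `F^ρ_r = {e | D_{ρ,e} ≥ r}`. -/
def klyachko (D : Matrix Δ.rays α ℝ) (ρ : Δ.rays) (r : ℝ) : Set α := {e | r ≤ D ρ e}

/-- `h⁰_D(u)`: the rank of the flat of global sections `⋂_ρ F^ρ_{⟨u, v_ρ⟩}`. -/
noncomputable def h0 (M : Matroid α) (D : Matrix Δ.rays α ℝ) (u : Fin d → ℝ) : ℕ :=
  (M.eRk (⋂ ρ : Δ.rays, klyachko D ρ (u ⬝ᵥ toReal (ρ : Fin d → ℤ)))).toNat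

/-- `h(D) = ∑_u h⁰_D(u)`, the sum over all lattice points `u`. -/
noncomputable def totalSections (M : Matroid α) (D : Matrix Δ.rays α ℝ) : ℕ :=
  ∑ᶠ u : Fin d → ℤ, h0 M D (toReal u)

/-- The matrix with prescribed integral entries, as a real matrix. -/
def ofEntries (x : Δ.rays × α → ℤ) : Matrix Δ.rays α ℝ := Matrix.of fun ρ e => (x (ρ, e) : ℝ)

end Diagrams

section PiecewisePolynomial

variable {ι : Type*} [Fintype ι]

/-- The rational polyhedral cone in `ℝ^ι` cut out by finitely many integral linear inequalities. -/
def ineqCone (A : Finset (ι → ℤ)) : Set (ι → ℝ) := {x | ∀ a ∈ A, 0 ≤ toReal a ⬝ᵥ x}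

/-- The function `f`, considered on a set `S` of lattice points of `ℝ^ι`, is piecewise polynomial
of degree `k`: the space `ℝ^ι` is a union of finitely many rational polyhedral cones such that, on
the points of `S` in any one of these cones, `f` is given by a polynomial of (total) degree `k`. -/
def IsPiecewisePolynomialOn (S : Set (ι → ℤ)) (f : (ι → ℤ) → ℕ) (k : ℕ) : Prop :=
  ∃ 𝒞 : Finset (Finset (ι → ℤ)),
    (∀ x : ι → ℝ, ∃ A ∈ 𝒞, x ∈ ineqCone A) ∧
    ∀ A ∈ 𝒞, ∃ p : MvPolynomial ι ℚ, p.totalDegree = k ∧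
      ∀ x ∈ S, toReal x ∈ ineqCone A → (f x : ℚ) = MvPolynomial.eval (fun i => (x i : ℚ)) p

end PiecewisePolynomial

theorem Fan.rays_eq_of_hull_eq {d : ℕ} {v w : Fin d → ℤ} (hv : Finset.univ.gcd v = 1)
    (hw : Finset.univ.gcd w = 1)
    (h : PointedCone.hull ℝ {toReal v} = PointedCone.hull ℝ {toReal w}) : v = w := by
  have h1 : toReal v ∈ PointedCone.hull ℝ {toReal w} := h ▸ Submodule.mem_span_singleton_self _
  obtain ⟨c, hc⟩ := Submodule.mem_span_singleton.1 h1
  have hc' : ∀ i, (c : ℝ) * (w i : ℝ) = (v i : ℝ) := fun i => congrFun hc i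
  obtain ⟨a, ha⟩ := Finset.gcd_eq_sum_mul Finset.univ v
  rw [hv] at ha
  set k : ℤ := ∑ i, w i * a i with hk
  have hck : (c : ℝ) * (k : ℝ) = 1 := by
    have : ((∑ i, v i * a i : ℤ) : ℝ) = 1 := by rw [← ha]; simp
    rw [← this, hk]
    push_cast
    rw [Finset.mul_sum]
    exact Finset.sum_congr rfl fun i _ => by rw [← hc' i]; ring
  have hkv : ∀ i, w i = k * v i := fun i => by
    have : (w i : ℝ) = (k : ℝ) * (v i : ℝ) := by
      rw [← hc' i, ← mul_assoc, mul_comm (k : ℝ), hck, one_mul]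
    exact_mod_cast this
  have hdvd : k ∣ 1 := hw ▸ Finset.dvd_gcd fun i _ => ⟨v i, hkv i⟩
  have hpos : 0 < k := by
    by_contra hneg
    have h2 : (k : ℝ) ≤ 0 := by exact_mod_cast not_lt.1 hneg
    have h3 : (0 : ℝ) ≤ c := c.2
    nlinarith
  have hk1 : k = 1 := Int.eq_one_of_dvd_one hpos.le hdvd
  funext i
  rw [hkv i, hk1, one_mul]

instance Fan.finite_rays {d : ℕ} (Δ : Fan d) : Finite Δ.rays := by
  have := Δ.finite.to_subtype
  refine Finite.of_injective
    (fun v : Δ.rays => (⟨PointedCone.hull ℝ {toReal v.1}, v.2.2⟩ : Δ.cones)) ?_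
  intro v w h
  exact Subtype.ext (Fan.rays_eq_of_hull_eq v.2.1 w.2.1 (congrArg Subtype.val h))

noncomputable instance Fan.fintypeRays {d : ℕ} (Δ : Fan d) : Fintype Δ.rays := Fintype.ofFinite _

end TropBundle

open TropBundle

namespace TropBundle

/-! The elements `e` with `u ∈ P_{D,e}` form a flat, because superlevel sets of Bergman vectors are
flats (`isFlat_superlevel`). Möbius inversion on the poset of nonempty flats writes the rank of a
flat `G` as the sum of `c F` over `F ⊆ G`. Since `F ⊆ G` means `u ∈ P_{D,F}` when `G` is the flat of
`u`, summing over `u` gives the sum of `c F` times the number of lattice points of `P_{D,F}`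
(`exists_totalSections_eq_sum`).

The support numbers of `P_{D,F}` are the row minima of `D` over `F`. Fixing where these minima are
attained cuts out a rational cone on which each support number is a single entry of `D`. It remains
to see that a polyhedron whose normal fan is a fixed smooth complete fan has a lattice point count
polynomial of degree at most `d` in its support numbers (`exists_polynomial_ncard`).

For this, the Brianchon–Gram identity `sum_cones_eq_ind` writes the indicator of the polyhedron as a
signed sum of indicators of tangent cones. In exponential generating functions the cones containing
lines contribute zero, and by smoothness a vertex cone contributes `exp (ℓ X)` divided by a product
of `d` factors `1 - exp (c X)`, where `ℓ` is linear in the support numbers and the factors do not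
depend on them. The count is the constant term of the total, hence polynomial.

The degree is exactly `d` because scaling an ample `D` stays in the cone and is again ample, while
the number of lattice points of one `P_{D,F}`, a lower bound for the total, grows like the `d`-th
power of the scale. -/

/-- The rational number `1` if `P` holds and `0` otherwise. -/
noncomputable def ind (P : Prop) : ℚ := @ite _ P (Classical.propDecidable P) 1 0

theorem ind_eq_ite (P : Prop) [Decidable P] : ind P = if P then 1 else 0 := by
  unfold ind; congr

theorem ind_of {P : Prop} (h : P) : ind P = 1 := if_pos h

theorem ind_of_not {P : Prop} (h : ¬ P) : ind P = 0 := if_neg h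

/-! ### Exponential generating functions of lattice cones -/

section GeneratingFunction

open PowerSeries

/-- The power series `exp (c X)`. -/
noncomputable def expSeries (c : ℚ) : ℚ⟦X⟧ := rescale c (exp ℚ)

theorem expSeries_add (a b : ℚ) : expSeries (a + b) = expSeries a * expSeries b :=
  (exp_mul_exp_eq_exp_add a b).symm

theorem coeff_expSeries (c : ℚ) (n : ℕ) : coeff n (expSeries c) = c ^ n / n.factorial := by
  simp [expSeries, coeff_rescale, coeff_exp, div_eq_mul_inv]

theorem exists_one_sub_expSeries_mul {c : ℚ} (hc : c ≠ 0) :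
    ∃ U : ℚ⟦X⟧, (1 - expSeries c) * U = X := by
  have h0 : constantCoeff (1 - expSeries c) = 0 := by
    rw [← coeff_zero_eq_constantCoeff_apply, map_sub, coeff_expSeries]; simp
  obtain ⟨W, hW⟩ := X_dvd_iff.2 h0
  have h1 : constantCoeff W = -c := by
    have := congrArg (coeff 1) hW
    rw [map_sub, coeff_expSeries, coeff_one, ← zero_add 1, coeff_succ_X_mul] at this
    simpa using this.symm
  exact ⟨W⁻¹, by rw [hW, mul_assoc, PowerSeries.mul_inv_cancel _ (by simpa [h1] using hc), mul_one]⟩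

theorem one_sub_expSeries_ne_zero {c : ℚ} (hc : c ≠ 0) : 1 - expSeries c ≠ 0 := by
  obtain ⟨U, hU⟩ := exists_one_sub_expSeries_mul hc
  intro h
  rw [h, zero_mul] at hU
  exact X_ne_zero hU.symm

variable {V : Type*} [AddCommGroup V]

/-- The difference operator `f ↦ f - f(· - m)`. -/
def diffOp (m : V) (f : V → ℚ) : V → ℚ := fun u => f u - f (u - m)

/-- The composite of the difference operators of a list of vectors. -/
def diffOps (L : List V) (f : V → ℚ) : V → ℚ := L.foldr diffOp f

theorem diffOp_comm (m n : V) (f : V → ℚ) : diffOp m (diffOp n f) = diffOp n (diffOp m f) := by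
  funext u
  simp only [diffOp, sub_right_comm u m n]
  ring

theorem diffOp_diffOps (m : V) (L : List V) (f : V → ℚ) :
    diffOp m (diffOps L f) = diffOps L (diffOp m f) := by
  induction L with
  | nil => rfl
  | cons n L ih =>
    change diffOp m (diffOp n (diffOps L f)) = diffOp n (diffOps L (diffOp m f))
    rw [diffOp_comm, ih]

theorem diffOps_append (L L' : List V) (f : V → ℚ) :
    diffOps (L ++ L') f = diffOps L (diffOps L' f) := List.foldr_append ..

theorem diffOps_comm (L L' : List V) (f : V → ℚ) :
    diffOps L (diffOps L' f) = diffOps L' (diffOps L f) := by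
  induction L with
  | nil => rfl
  | cons n L ih =>
    change diffOp n (diffOps L (diffOps L' f)) = diffOps L' (diffOp n (diffOps L f))
    rw [ih, diffOp_diffOps]

theorem diffOps_add (L : List V) (f g : V → ℚ) :
    diffOps L (f + g) = diffOps L f + diffOps L g := by
  induction L with
  | nil => rfl
  | cons n L ih =>
    change diffOp n (diffOps L (f + g)) = diffOp n (diffOps L f) + diffOp n (diffOps L g)
    rw [ih]
    funext u
    simp only [diffOp, Pi.add_apply]
    ring

theorem diffOps_smul (L : List V) (c : ℚ) (f : V → ℚ) :
    diffOps L (c • f) = c • diffOps L f := by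
  induction L with
  | nil => rfl
  | cons n L ih =>
    change diffOp n (diffOps L (c • f)) = c • diffOp n (diffOps L f)
    rw [ih]
    funext u
    simp only [diffOp, Pi.smul_apply, smul_eq_mul]
    ring

variable (ξ : V →+ ℚ)

/-- The exponential generating function `∑ f(u) exp(ξ(u) X)`. -/
noncomputable def expSum : (V →₀ ℚ) →ₗ[ℚ] ℚ⟦X⟧ :=
  Finsupp.linearCombination ℚ fun u => expSeries (ξ u)

theorem expSum_single (u : V) (c : ℚ) : expSum ξ (Finsupp.single u c) = c • expSeries (ξ u) :=
  Finsupp.linearCombination_single ..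

theorem coeff_zero_expSum (F : V →₀ ℚ) : coeff 0 (expSum ξ F) = F.sum fun _ c => c := by
  rw [expSum, Finsupp.linearCombination_apply, Finsupp.sum, map_sum, Finsupp.sum]
  refine Finset.sum_congr rfl fun u _ => ?_
  rw [map_smul, coeff_expSeries]
  simp

/-- Translating by `m` multiplies the generating function by `exp (ξ(m) X)`. -/
theorem exists_diffOp_finsupp (m : V) (F : V →₀ ℚ) :
    ∃ F' : V →₀ ℚ, ⇑F' = diffOp m F ∧ expSum ξ F' = (1 - expSeries (ξ m)) * expSum ξ F := by
  refine ⟨F - F.mapDomain (Equiv.addRight m), ?_, ?_⟩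
  · funext u
    rw [Finsupp.sub_apply, Finsupp.mapDomain_equiv_apply]
    simp [diffOp, sub_eq_add_neg]
  · rw [map_sub, sub_mul, one_mul]
    congr 1
    induction F using Finsupp.induction_linear with
    | zero => simp
    | add f g hf hg => rw [Finsupp.mapDomain_add, map_add, map_add, hf, hg, mul_add]
    | single u c =>
      rw [Finsupp.mapDomain_single, expSum_single, expSum_single, Equiv.coe_addRight, map_add,
        add_comm, expSeries_add, mul_smul_comm]

theorem exists_diffOps_finsupp (L : List V) (F : V →₀ ℚ) :
    ∃ F' : V →₀ ℚ, ⇑F' = diffOps L F ∧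
      expSum ξ F' = (L.map fun m => 1 - expSeries (ξ m)).prod * expSum ξ F := by
  induction L with
  | nil => exact ⟨F, rfl, by simp⟩
  | cons m L ih =>
    obtain ⟨G, hG, hG'⟩ := ih
    obtain ⟨H, hH, hH'⟩ := exists_diffOp_finsupp ξ m G
    refine ⟨H, by rw [hH, hG]; rfl, ?_⟩
    rw [hH', hG', List.map_cons, List.prod_cons, mul_assoc]

theorem prod_one_sub_expSeries_ne_zero {L : List V} (hL : ∀ m ∈ L, ξ m ≠ 0) :
    (L.map fun m => 1 - expSeries (ξ m)).prod ≠ 0 := by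
  rw [Ne, List.prod_eq_zero_iff, List.mem_map]
  rintro ⟨m, hm, h⟩
  exact one_sub_expSeries_ne_zero (hL m hm) h

/-- The function `f` becomes finitely supported after applying difference operators, and
`X ^ (-d) g` is the generating function obtained from it by division. -/
def HasGenFun (d : ℕ) (f : V → ℚ) (g : ℚ⟦X⟧) : Prop :=
  ∃ L : List V, (∀ m ∈ L, ξ m ≠ 0) ∧ ∃ F : V →₀ ℚ, ⇑F = diffOps L f ∧
    X ^ d * expSum ξ F = (L.map fun m => 1 - expSeries (ξ m)).prod * g

variable {ξ} {d : ℕ}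

/-- As with adding fractions, the two lists are concatenated to give a common denominator. -/
theorem HasGenFun.add {f₁ f₂ : V → ℚ} {g₁ g₂ : ℚ⟦X⟧} (h₁ : HasGenFun ξ d f₁ g₁)
    (h₂ : HasGenFun ξ d f₂ g₂) : HasGenFun ξ d (f₁ + f₂) (g₁ + g₂) := by
  obtain ⟨L₁, hL₁, F₁, hF₁, hg₁⟩ := h₁
  obtain ⟨L₂, hL₂, F₂, hF₂, hg₂⟩ := h₂
  obtain ⟨G₁, hG₁, hG₁'⟩ := exists_diffOps_finsupp ξ L₂ F₁
  obtain ⟨G₂, hG₂, hG₂'⟩ := exists_diffOps_finsupp ξ L₁ F₂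
  refine ⟨L₁ ++ L₂, fun m hm => (List.mem_append.1 hm).elim (hL₁ m) (hL₂ m), G₁ + G₂, ?_, ?_⟩
  · rw [diffOps_add, diffOps_append, diffOps_append, Finsupp.coe_add, hG₁, hG₂, hF₁, hF₂,
      diffOps_comm L₂ L₁ f₁]
  · rw [map_add, hG₁', hG₂', List.map_append, List.prod_append, mul_add, mul_add,
      mul_left_comm, hg₁, mul_left_comm _ _ (expSum ξ F₂), hg₂]
    ring

theorem HasGenFun.smul {f : V → ℚ} {g : ℚ⟦X⟧} (c : ℚ) (h : HasGenFun ξ d f g) :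
    HasGenFun ξ d (c • f) (c • g) := by
  obtain ⟨L, hL, F, hF, hg⟩ := h
  refine ⟨L, hL, c • F, ?_, ?_⟩
  · rw [diffOps_smul, Finsupp.coe_smul, hF]
  · rw [map_smul, mul_smul_comm, hg, mul_smul_comm]

theorem hasGenFun_zero : HasGenFun ξ d 0 0 :=
  ⟨[], by simp, 0, rfl, by simp⟩

theorem HasGenFun.sum {κ : Type*} (s : Finset κ) {f : κ → V → ℚ} {g : κ → ℚ⟦X⟧}
    (h : ∀ k ∈ s, HasGenFun ξ d (f k) (g k)) :
    HasGenFun ξ d (∑ k ∈ s, f k) (∑ k ∈ s, g k) := by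
  classical
  induction s using Finset.induction_on with
  | empty => exact hasGenFun_zero
  | insert k s hk ih =>
    rw [Finset.sum_insert hk, Finset.sum_insert hk]
    exact (h k (Finset.mem_insert_self ..)).add
      (ih fun j hj => h j (Finset.mem_insert_of_mem hj))

/-- The formal quotient is the honest generating function when the support is finite: power series
over `ℚ` form a domain, and the denominator is nonzero because `ξ` is nonzero on the list. -/
theorem HasGenFun.eq_of_finsupp {F : V →₀ ℚ} {g : ℚ⟦X⟧} (h : HasGenFun ξ d F g) :
    X ^ d * expSum ξ F = g := by
  obtain ⟨L, hL, F', hF', hg⟩ := h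
  obtain ⟨G, hG, hG'⟩ := exists_diffOps_finsupp ξ L F
  obtain rfl : F' = G := DFunLike.coe_injective (hF'.trans hG.symm)
  rw [hG', mul_left_comm] at hg
  exact mul_left_cancel₀ (prod_one_sub_expSeries_ne_zero ξ hL) hg

/-- One difference operator annihilates a periodic function. This removes the tangent cones that
contain a line. -/
theorem hasGenFun_of_periodic {f : V → ℚ} {m : V} (hm : ξ m ≠ 0) (hf : ∀ u, f (u - m) = f u) :
    HasGenFun ξ d f 0 := by
  refine ⟨[m], by simpa using hm, 0, ?_, by simp⟩
  funext u
  simp [diffOps, diffOp, hf]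

/-- Subtracting the translate of the orthant by `-m j` leaves the facet `p j = a j`, so each
operator turns one inequality into an equation. -/
theorem diffOps_orthant {ι : Type*} {p : ι → V →+ ℤ} {m : ι → V} (hpm : ∀ i, p i (m i) = 1)
    (hpm' : ∀ i j, i ≠ j → p i (m j) = 0) (a : ι → ℤ) (l : List ι) (hl : l.Nodup) :
    diffOps (l.map fun i => -m i) (fun u => ind (∀ i, p i u ≤ a i)) =
      fun u => ind ((∀ i, p i u ≤ a i) ∧ ∀ i ∈ l, p i u = a i) := by
  classical
  induction l with
  | nil => simp [diffOps]
  | cons j l ih =>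
    rw [List.nodup_cons] at hl
    change diffOp (-m j) (diffOps (l.map fun i => -m i) _) = _
    rw [ih hl.2]
    funext u
    have key : ((∀ i, p i (u - -m j) ≤ a i) ∧ ∀ i ∈ l, p i (u - -m j) = a i) ↔
        ((∀ i, p i u ≤ a i) ∧ ∀ i ∈ l, p i u = a i) ∧ p j u + 1 ≤ a j := by
      simp only [sub_neg_eq_add, map_add]
      constructor
      · rintro ⟨h1, h2⟩
        refine ⟨⟨fun i => ?_, fun i hi => ?_⟩, by simpa [hpm] using h1 j⟩
        · by_cases hij : i = j
          · subst hij; have := h1 i; rw [hpm] at this; omega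
          · simpa [hpm' i j hij] using h1 i
        · have hij : i ≠ j := fun h => hl.1 (h ▸ hi)
          simpa [hpm' i j hij] using h2 i hi
      · rintro ⟨⟨h1, h2⟩, h3⟩
        refine ⟨fun i => ?_, fun i hi => ?_⟩
        · by_cases hij : i = j
          · subst hij; rwa [hpm]
          · simpa [hpm' i j hij] using h1 i
        · have hij : i ≠ j := fun h => hl.1 (h ▸ hi)
          simpa [hpm' i j hij] using h2 i hi
    simp only [diffOp, key, List.mem_cons, forall_eq_or_imp]
    by_cases hQ : (∀ i, p i u ≤ a i) ∧ ∀ i ∈ l, p i u = a i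
    · rcases (hQ.1 j).eq_or_lt with h | h
      · rw [ind_of hQ, ind_of_not fun h' => by omega, ind_of ⟨hQ.1, h, hQ.2⟩, sub_zero]
      · rw [ind_of hQ, ind_of ⟨hQ, h⟩, ind_of_not fun h' => h.ne h'.2.1, sub_self]
    · rw [ind_of_not hQ, ind_of_not fun h => hQ h.1, ind_of_not fun h => hQ ⟨h.1, h.2.2⟩, sub_zero]

/-- All difference operators together leave only the apex `∑ a i • m i`. The point of the form is
that `U` is chosen before `a`: translating the orthant affects only the exponential. -/
theorem exists_hasGenFun_orthant {ι : Type*} [Fintype ι] {p : ι → V →+ ℤ} {m : ι → V}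
    (hpm : ∀ i, p i (m i) = 1) (hpm' : ∀ i j, i ≠ j → p i (m j) = 0)
    (hinj : ∀ u v, (∀ i, p i u = p i v) → u = v) (hξ : ∀ i, ξ (m i) ≠ 0) :
    ∃ U : ℚ⟦X⟧, ∀ a : ι → ℤ,
      HasGenFun ξ (Fintype.card ι) (fun u => ind (∀ i, p i u ≤ a i))
        (expSeries (∑ i, a i * ξ (m i)) * U) := by
  classical
  have hξ' : ∀ i, ξ (-m i) ≠ 0 := fun i => by simpa using hξ i
  choose U hU using fun i => exists_one_sub_expSeries_mul (hξ' i)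
  refine ⟨∏ i, U i, fun a => ⟨(Finset.univ.toList.map fun i => -m i), ?_, ?_⟩⟩
  · simpa using hξ
  set v : V := ∑ i, a i • m i with hv
  have hpv : ∀ i, p i v = a i := fun i => by
    rw [hv, map_sum, Finset.sum_eq_single i]
    · simp [hpm]
    · intro j _ hj; simp [hpm' i j hj.symm]
    · simp
  refine ⟨Finsupp.single v 1, ?_, ?_⟩
  · rw [diffOps_orthant hpm hpm' a _ (Finset.nodup_toList _)]
    funext u
    rw [Finsupp.single_apply, ind_eq_ite]
    refine if_congr ⟨?_, ?_⟩ rfl rfl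
    · rintro rfl
      exact ⟨fun i => (hpv i).le, fun i _ => hpv i⟩
    · exact fun h => hinj _ _ fun i => (hpv i).trans (h.2 i (by simp)).symm
  · have h1 : ξ v = ∑ i, a i * ξ (m i) := by simp [hv]
    have h2 : ((Finset.univ.toList.map fun i => -m i).map fun m => 1 - expSeries (ξ m)).prod =
        ∏ i, (1 - expSeries (ξ (-m i))) := by
      rw [List.map_map]
      exact Finset.prod_map_toList ..
    rw [h2, expSum_single, one_smul, h1, mul_left_comm, ← Finset.prod_mul_distrib,
      Finset.prod_congr rfl fun i _ => hU i, Finset.prod_const, Finset.card_univ, mul_comm]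

end GeneratingFunction


/-! ### Dual bases and cones spanned by part of a lattice basis -/

section LatticeBasis

variable {d : ℕ}

theorem toReal_dotProduct (u v : Fin d → ℤ) : toReal u ⬝ᵥ toReal v = ((u ⬝ᵥ v : ℤ) : ℝ) := by
  simp [toReal, dotProduct]

theorem toReal_injective {ι : Type*} : Function.Injective (toReal : (ι → ℤ) → ι → ℝ) :=
  fun _ _ h => funext fun i => Int.cast_injective (congrFun h i)

variable (b : Module.Basis (Fin d) ℤ (Fin d → ℤ))

/-- The vectors of the basis dual to a lattice basis `b`. -/
noncomputable def dualVec (i : Fin d) : Fin d → ℤ := fun k => b.repr (Pi.single k 1) i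

theorem dotProduct_dualVec (v : Fin d → ℤ) (i : Fin d) : v ⬝ᵥ dualVec b i = b.repr v i := by
  conv_rhs => rw [pi_eq_sum_univ' v]
  rw [map_sum, Finsupp.finsetSum_apply]
  refine Finset.sum_congr rfl fun k _ => ?_
  rw [map_smul, Finsupp.smul_apply, smul_eq_mul, dualVec]

theorem dotProduct_dualVec_basis (i j : Fin d) :
    b j ⬝ᵥ dualVec b i = if j = i then 1 else 0 := by
  rw [dotProduct_dualVec, b.repr_self, Finsupp.single_apply]

theorem sum_dualVec_mul (k l : Fin d) :
    ∑ i, dualVec b i k * b i l = if k = l then 1 else 0 := by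
  have := congrFun (b.sum_repr (Pi.single k 1)) l
  rw [Finset.sum_apply, Pi.single_apply] at this
  simp only [Pi.smul_apply, smul_eq_mul] at this
  simp only [dualVec, this, eq_comm]

/-- The coordinate functions on `ℝᵈ` with respect to a lattice basis. -/
noncomputable def rcoord (i : Fin d) : (Fin d → ℝ) →ₗ[ℝ] ℝ :=
  (LinearMap.proj i).comp (Matrix.mulVecLin (Matrix.of fun i => toReal (dualVec b i)))

theorem rcoord_apply (i : Fin d) (x : Fin d → ℝ) :
    rcoord b i x = x ⬝ᵥ toReal (dualVec b i) := by
  rw [dotProduct_comm]; rfl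

theorem rcoord_basis (i j : Fin d) : rcoord b i (toReal (b j)) = if j = i then 1 else 0 := by
  rw [rcoord_apply, toReal_dotProduct, dotProduct_dualVec_basis]
  push_cast
  rfl

theorem toReal_basis_ne_zero (i : Fin d) : toReal (b i) ≠ 0 := fun h => by
  have h2 := rcoord_basis b i i
  rw [h, map_zero, if_pos rfl] at h2
  exact zero_ne_one h2

theorem sum_rcoord_smul (x : Fin d → ℝ) : ∑ i, rcoord b i x • toReal (b i) = x := by
  funext l
  rw [Finset.sum_apply]
  simp only [Pi.smul_apply, smul_eq_mul, rcoord_apply, dotProduct, Finset.sum_mul]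
  rw [Finset.sum_comm]
  have h : ∀ k, ∑ i, x k * toReal (dualVec b i) k * toReal (b i) l =
      x k * (if k = l then 1 else 0) := fun k => by
    have := congrArg (Int.cast : ℤ → ℝ) (sum_dualVec_mul b k l)
    push_cast at this
    rw [← this, Finset.mul_sum]
    exact Finset.sum_congr rfl fun i _ => mul_assoc ..
  simp [h]

theorem ext_rcoord {x y : Fin d → ℝ} (h : ∀ i, rcoord b i x = rcoord b i y) : x = y := by
  rw [← sum_rcoord_smul b x, ← sum_rcoord_smul b y]
  exact Finset.sum_congr rfl fun i _ => by rw [h]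

/-- The cone spanned by part of a lattice basis. -/
noncomputable def basisCone (s : Set (Fin d)) : PointedCone ℝ (Fin d → ℝ) :=
  PointedCone.hull ℝ ((fun i => toReal (b i)) '' s)

variable {b} {s t : Set (Fin d)}

theorem mem_basisCone {x : Fin d → ℝ} :
    x ∈ basisCone b s ↔ ∀ i, 0 ≤ rcoord b i x ∧ (i ∉ s → rcoord b i x = 0) := by
  classical
  constructor
  · intro h
    induction h using Submodule.span_induction with
    | mem x hx =>
      obtain ⟨j, hj, rfl⟩ := hx
      intro i
      simp only [rcoord_basis]
      by_cases hij : j = i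
      · subst hij; simp [hj]
      · simp [hij]
    | zero => simp
    | add x y _ _ hx hy =>
      intro i
      rw [map_add]
      exact ⟨add_nonneg (hx i).1 (hy i).1, fun hi => by rw [(hx i).2 hi, (hy i).2 hi, add_zero]⟩
    | smul c x _ hx =>
      intro i
      have : rcoord b i (c • x) = (c : ℝ) * rcoord b i x := map_smul (rcoord b i) (c : ℝ) x
      rw [this]
      exact ⟨mul_nonneg c.2 (hx i).1, fun hi => by rw [(hx i).2 hi, mul_zero]⟩
  · intro h
    rw [← sum_rcoord_smul b x]
    refine Submodule.sum_mem _ fun i _ => ?_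
    by_cases hi : i ∈ s
    · exact PointedCone.smul_mem _ (h i).1 (Submodule.subset_span ⟨i, hi, rfl⟩)
    · rw [(h i).2 hi, zero_smul]; exact Submodule.zero_mem _

theorem basis_mem_basisCone {i : Fin d} : toReal (b i) ∈ basisCone b s ↔ i ∈ s := by
  rw [mem_basisCone]
  constructor
  · intro h
    by_contra hi
    simpa [rcoord_basis] using (h i).2 hi
  · intro hi j
    rw [rcoord_basis]
    by_cases hij : i = j
    · subst hij; simp [hi]
    · simp [hij]

theorem eq_zero_of_mem_basisCone_empty {x : Fin d → ℝ} (hx : x ∈ basisCone b ∅) : x = 0 :=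
  ext_rcoord b fun j => by rw [(mem_basisCone.1 hx j).2 (by simp), map_zero]

theorem isFaceOf_basisCone (hst : s ⊆ t) : (basisCone b s).IsFaceOf (basisCone b t) where
  le := Submodule.span_mono (Set.image_mono hst)
  mem_of_smul_add_mem := by
    intro x y a hx hy ha h
    rw [mem_basisCone] at *
    intro i
    refine ⟨(hx i).1, fun hi => ?_⟩
    have h1 := (h i).2 hi
    rw [map_add, map_smul, smul_eq_mul] at h1
    have h2 := mul_nonneg ha.le (hx i).1
    have h3 : a * rcoord b i x = 0 := by linarith [(hy i).1]
    exact (mul_eq_zero.1 h3).resolve_left ha.ne'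

theorem gcd_basis (i : Fin d) : Finset.univ.gcd (b i) = 1 := by
  have h : Finset.univ.gcd (b i) ∣ 1 := by
    have := dotProduct_dualVec_basis b i i
    rw [if_pos rfl] at this
    rw [← this]
    exact Finset.dvd_sum fun k hk => (Finset.gcd_dvd hk).mul_right _
  have := Finset.normalize_gcd (s := Finset.univ) (f := b i)
  rw [← this]
  exact normalize_eq_one.2 (isUnit_of_dvd_one h)

end LatticeBasis

/-! ### Rays and faces of smooth fans -/

namespace Fan

variable {d : ℕ} {Δ : Fan d}

/-- A choice of lattice bases part of which span the cones of a fan. -/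
structure Charts (Δ : Fan d) where
  basis : Δ.cones → Module.Basis (Fin d) ℤ (Fin d → ℤ)
  idx : Δ.cones → Set (Fin d)
  cone_eq : ∀ σ : Δ.cones, σ.1 = basisCone (basis σ) (idx σ)

theorem IsSmooth.nonempty_charts (h : Δ.IsSmooth) : Nonempty Δ.Charts := by
  choose b s hbs using fun σ : Δ.cones => h σ.1 σ.2
  exact ⟨⟨b, s, hbs⟩⟩

namespace Charts

variable (C : Δ.Charts)

theorem basisCone_mem {σ : Δ.cones} {T : Set (Fin d)} (hT : T ⊆ C.idx σ) :
    basisCone (C.basis σ) T ∈ Δ.cones :=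
  Δ.face_mem σ.1 σ.2 _ (C.cone_eq σ ▸ isFaceOf_basisCone hT)

theorem basis_mem_cone {σ : Δ.cones} {i : Fin d} :
    toReal (C.basis σ i) ∈ σ.1 ↔ i ∈ C.idx σ := by
  rw [C.cone_eq σ, basis_mem_basisCone]

theorem basis_mem_rays {σ : Δ.cones} {i : Fin d} (hi : i ∈ C.idx σ) :
    C.basis σ i ∈ Δ.rays := by
  refine ⟨gcd_basis i, ?_⟩
  have := C.basisCone_mem (σ := σ) (T := {i}) (by simpa using hi)
  rwa [basisCone, Set.image_singleton] at this

/-- The ray of `v` is a face of `σ`. Some coordinate of `v` is positive, so the corresponding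
generator is, up to scale, a summand of `v` and lies in that face; primitivity then makes the two
equal. -/
theorem exists_eq_basis {σ : Δ.cones} {v : Fin d → ℤ} (hv : v ∈ Δ.rays)
    (hvσ : toReal v ∈ σ.1) : ∃ i ∈ C.idx σ, v = C.basis σ i := by
  have hface : (PointedCone.hull ℝ {toReal v}).IsFaceOf σ.1 := by
    have h := Δ.inter_isFace σ.1 σ.2 _ hv.2
    rwa [inf_eq_right.2 (Submodule.span_le.2 (by simpa using hvσ))] at h
  have hmem := hvσ
  rw [C.cone_eq σ, mem_basisCone] at hmem
  have hv0 : ∃ i, rcoord (C.basis σ) i (toReal v) ≠ 0 := by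
    by_contra! h
    have h0 : toReal v = 0 := ext_rcoord (C.basis σ) fun i => by rw [h i, map_zero]
    have h1 : v = 0 := toReal_injective (h0.trans (by ext; simp [toReal]))
    have h2 := hv.1
    rw [h1, Finset.gcd_eq_zero_iff.2 (by simp)] at h2
    exact zero_ne_one h2
  obtain ⟨i, hi⟩ := hv0
  have his : i ∈ C.idx σ := by
    by_contra h
    exact hi ((hmem i).2 h)
  refine ⟨i, his, ?_⟩
  have hbi : toReal (C.basis σ i) ∈ PointedCone.hull ℝ {toReal v} := by
    refine hface.mem_of_smul_add_mem (a := rcoord (C.basis σ) i (toReal v))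
      (y := toReal v - rcoord (C.basis σ) i (toReal v) • toReal (C.basis σ i))
      (C.basis_mem_cone.2 his) ?_ (lt_of_le_of_ne (hmem i).1 hi.symm) ?_
    · rw [C.cone_eq σ, mem_basisCone]
      intro j
      rw [map_sub, map_smul, rcoord_basis]
      by_cases hij : i = j
      · subst hij; simp
      · simpa [hij] using hmem j
    · rw [add_sub_cancel]
      exact Submodule.mem_span_singleton_self _
  refine Fan.rays_eq_of_hull_eq hv.1 (gcd_basis i) (le_antisymm ?_ ?_)
  · obtain ⟨c, hc⟩ := Submodule.mem_span_singleton.1 hbi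
    have hc0 : (c : ℝ) ≠ 0 := by
      intro h
      refine toReal_basis_ne_zero (C.basis σ) i ?_
      rw [← hc]
      change (c : ℝ) • toReal v = 0
      rw [h, zero_smul]
    rw [PointedCone.hull, Submodule.span_singleton_le_iff_mem]
    have : toReal v = (c : ℝ)⁻¹ • toReal (C.basis σ i) := by
      rw [← hc]
      change _ = (c : ℝ)⁻¹ • (c : ℝ) • toReal v
      rw [inv_smul_smul₀ hc0]
    rw [this]
    exact PointedCone.smul_mem _ (inv_nonneg.2 c.2) (Submodule.mem_span_singleton_self _)
  · exact (Submodule.span_singleton_le_iff_mem ..).2 hbi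

theorem rays_in_cone_eq (σ : Δ.cones) :
    {v | v ∈ Δ.rays ∧ toReal v ∈ σ.1} = C.basis σ '' C.idx σ := by
  ext v
  constructor
  · rintro ⟨h1, h2⟩
    obtain ⟨i, hi, rfl⟩ := C.exists_eq_basis h1 h2
    exact ⟨i, hi, rfl⟩
  · rintro ⟨i, hi, rfl⟩
    exact ⟨C.basis_mem_rays hi, C.basis_mem_cone.2 hi⟩

theorem rays_in_face_eq {σ τ : Δ.cones} (h : τ.1 ≤ σ.1) :
    {v | v ∈ Δ.rays ∧ toReal v ∈ τ.1} =
      C.basis σ '' {i | toReal (C.basis σ i) ∈ τ.1} := by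
  ext v
  constructor
  · rintro ⟨h1, h2⟩
    obtain ⟨i, hi, rfl⟩ := C.exists_eq_basis h1 (h h2)
    exact ⟨i, h2, rfl⟩
  · rintro ⟨i, hi, rfl⟩
    exact ⟨C.basis_mem_rays (C.basis_mem_cone.1 (h hi)), hi⟩

theorem cone_eq_of_le {σ τ : Δ.cones} (h : τ.1 ≤ σ.1) :
    τ.1 = basisCone (C.basis σ) {i | toReal (C.basis σ i) ∈ τ.1} := by
  have h1 := (C.rays_in_cone_eq τ).symm.trans (C.rays_in_face_eq h)
  conv_lhs => rw [C.cone_eq τ]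
  rw [basisCone, basisCone, ← Function.comp_def toReal, ← Function.comp_def toReal,
    Set.image_comp, Set.image_comp, h1]

theorem ncard_idx_of_le {σ τ : Δ.cones} (h : τ.1 ≤ σ.1) :
    (C.idx τ).ncard = {i | toReal (C.basis σ i) ∈ τ.1}.ncard := by
  have h1 := (C.rays_in_cone_eq τ).symm.trans (C.rays_in_face_eq h)
  rw [← Set.ncard_image_of_injective _ (C.basis τ).injective, h1,
    Set.ncard_image_of_injective _ (C.basis σ).injective]

/-- The vector `η` lies on none of the coordinate hyperplanes of the charts. -/
def IsGeneric (η : Fin d → ℝ) : Prop := ∀ σ i, rcoord (C.basis σ) i η ≠ 0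

-- For `x` in the relative interior of `τ`, the unique cone is the maximal cone containing `x + ε η`
-- for all small `ε > 0`. Completeness gives existence, and genericity keeps the perturbed point off
-- all walls.
open Filter Topology in
theorem existsUnique_cone (hc : Δ.IsComplete) {η : Fin d → ℝ} (hη : C.IsGeneric η)
    (τ : Δ.cones) :
    ∃! σ : Δ.cones, C.idx σ = Set.univ ∧ τ.1 ≤ σ.1 ∧
      ∀ i, toReal (C.basis σ i) ∉ τ.1 → 0 < rcoord (C.basis σ) i η := by
  classical
  have := Δ.finite.to_subtype
  set x : Fin d → ℝ := ∑ i, if i ∈ C.idx τ then toReal (C.basis τ i) else 0 with hx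
  -- As `τ ⊓ κ` is a face of `τ` containing the sum `x`, it contains every generator of `τ`.
  have hxcone : ∀ κ : Δ.cones, x ∈ κ.1 → τ.1 ≤ κ.1 := by
    intro κ hκ
    have hf := Δ.inter_isFace τ.1 τ.2 κ.1 κ.2
    have hi : ∀ i, (if i ∈ C.idx τ then toReal (C.basis τ i) else 0) ∈ τ.1 := by
      intro i
      split_ifs with h
      · exact C.basis_mem_cone.2 h
      · exact Submodule.zero_mem _
    have := hf.mem_of_sum_mem hi ⟨Submodule.sum_mem _ fun i _ => hi i, hκ⟩
    rw [C.cone_eq τ, basisCone, PointedCone.hull, Submodule.span_le]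
    rintro _ ⟨i, hi, rfl⟩
    have := (this i).2
    rwa [if_pos hi] at this
  have hxcoord : ∀ κ : Δ.cones, τ.1 ≤ κ.1 → ∀ i, rcoord (C.basis κ) i x =
      if toReal (C.basis κ i) ∈ τ.1 then 1 else 0 := by
    intro κ hκ i
    have h1 := (C.rays_in_cone_eq τ).symm.trans (C.rays_in_face_eq hκ)
    have h2 : x = ∑ j ∈ Finset.univ.filter (fun j => toReal (C.basis κ j) ∈ τ.1),
        toReal (C.basis κ j) := by
      rw [hx, ← Finset.sum_filter]
      rw [← Finset.sum_image (s := Finset.univ.filter (· ∈ C.idx τ)) (g := C.basis τ)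
        (f := toReal) ((C.basis τ).injective.injOn),
        ← Finset.sum_image (g := C.basis κ) (f := toReal) ((C.basis κ).injective.injOn)]
      refine Finset.sum_congr ?_ fun _ _ => rfl
      rw [← Finset.coe_inj]
      simpa using h1
    rw [h2, map_sum]
    simp only [rcoord_basis]
    rw [Finset.sum_ite_eq']
    simp
  have htend : Tendsto (fun n : ℕ => ((n : ℝ) + 1)⁻¹) atTop (𝓝 0) := by
    simpa using tendsto_one_div_add_atTop_nhds_zero_nat (𝕜 := ℝ)
  set y : ℕ → Fin d → ℝ := fun n => x + ((n : ℝ) + 1)⁻¹ • η with hy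
  have hycoord : ∀ κ i n, rcoord (C.basis κ) i (y n) =
      rcoord (C.basis κ) i x + ((n : ℝ) + 1)⁻¹ * rcoord (C.basis κ) i η := fun κ i n => by
    rw [hy, map_add, map_smul, smul_eq_mul]
  have hylim : ∀ κ i, Tendsto (fun n => rcoord (C.basis κ) i (y n)) atTop
      (𝓝 (rcoord (C.basis κ) i x)) := fun κ i => by
    simp only [hycoord]
    simpa using (htend.mul_const (rcoord (C.basis κ) i η)).const_add (rcoord (C.basis κ) i x)
  choose κ hκ using fun n => hc (y n)
  -- Pigeonhole: there are finitely many cones, so one contains `y n` for infinitely many `n`, and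
  -- in the limit it contains `x`.
  obtain ⟨σ, hσ⟩ : ∃ σ : Δ.cones, ∃ᶠ n in atTop, (⟨κ n, (hκ n).1⟩ : Δ.cones) = σ := by
    by_contra! h
    have : ∀ᶠ n in atTop, ∀ σ : Δ.cones, (⟨κ n, (hκ n).1⟩ : Δ.cones) ≠ σ :=
      eventually_all.2 h
    obtain ⟨n, hn⟩ := this.exists
    exact hn _ rfl
  have hyσ : ∃ᶠ n in atTop, y n ∈ σ.1 := hσ.mono fun n hn => by
    rw [← hn]; exact (hκ n).2
  have hyσ' : ∃ᶠ n in atTop, ∀ i, 0 ≤ rcoord (C.basis σ) i (y n) ∧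
      (i ∉ C.idx σ → rcoord (C.basis σ) i (y n) = 0) := hyσ.mono fun n hn => by
    rwa [C.cone_eq σ, mem_basisCone] at hn
  have hxσ : x ∈ σ.1 := by
    rw [C.cone_eq σ, mem_basisCone]
    intro i
    constructor
    · by_contra! h
      have := (hylim σ i).eventually_lt_const h
      obtain ⟨n, hn, hn'⟩ := (hyσ'.and_eventually this).exists
      exact absurd (hn i).1 (not_le.2 hn')
    · intro hi
      by_contra h
      have := (hylim σ i).eventually_ne h
      obtain ⟨n, hn, hn'⟩ := (hyσ'.and_eventually this).exists
      exact hn' ((hn i).2 hi)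
  have hτσ := hxcone σ hxσ
  refine ⟨σ, ⟨?_, hτσ, ?_⟩, ?_⟩
  · ext i
    simp only [Set.mem_univ, iff_true]
    by_contra hi
    have h0 : rcoord (C.basis σ) i x = 0 := by
      rw [C.cone_eq σ, mem_basisCone] at hxσ
      exact (hxσ i).2 hi
    obtain ⟨n, hn⟩ := hyσ'.exists
    have := (hn i).2 hi
    rw [hycoord, h0, zero_add] at this
    exact hη σ i ((mul_eq_zero.1 this).resolve_left (by positivity))
  · intro i hi
    obtain ⟨n, hn⟩ := hyσ'.exists
    have := (hn i).1
    rw [hycoord, hxcoord σ hτσ, if_neg hi, zero_add] at this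
    exact lt_of_le_of_ne (nonneg_of_mul_nonneg_right this (by positivity)) (hη σ i).symm
  · have hpos : ∀ κ : Δ.cones, τ.1 ≤ κ.1 →
        (∀ i, toReal (C.basis κ i) ∉ τ.1 → 0 < rcoord (C.basis κ) i η) →
        ∀ᶠ n in atTop, ∀ i, 0 < rcoord (C.basis κ) i (y n) := by
      intro κ hκ h
      refine eventually_all.2 fun i => ?_
      by_cases hi : toReal (C.basis κ i) ∈ τ.1
      · refine (hylim κ i).eventually_const_lt ?_
        rw [hxcoord κ hκ, if_pos hi]
        exact one_pos
      · refine Eventually.of_forall fun n => ?_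
        rw [hycoord, hxcoord κ hκ, if_neg hi, zero_add]
        exact mul_pos (by positivity) (h i hi)
    have hpm : ∀ κ : Δ.cones, C.idx κ = Set.univ → ∀ z, (∀ i, 0 < rcoord (C.basis κ) i z) →
        z ∈ κ.1 := by
      intro κ hκ z hz
      rw [C.cone_eq κ, mem_basisCone]
      exact fun i => ⟨(hz i).le, fun hi => (hi (by simp [hκ])).elim⟩
    have hle : ∀ κ κ' : Δ.cones, C.idx κ = Set.univ → ∀ z, (∀ i, 0 < rcoord (C.basis κ) i z) →
        z ∈ κ'.1 → κ.1 ≤ κ'.1 := by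
      intro κ κ' hκ z hz hz'
      have hf := Δ.inter_isFace κ.1 κ.2 κ'.1 κ'.2
      have hmem : ∀ i, toReal (C.basis κ i) ∈ κ.1 := fun i => C.basis_mem_cone.2 (by simp [hκ])
      rw [C.cone_eq κ, basisCone, PointedCone.hull, Submodule.span_le]
      rintro _ ⟨i, -, rfl⟩
      refine (hf.mem_of_sum_smul_mem (f := fun i => toReal (C.basis κ i))
        (c := fun i => rcoord (C.basis κ) i z) hmem (fun i => (hz i).le) ?_ i (hz i)).2
      rw [sum_rcoord_smul]
      exact ⟨hpm κ hκ z hz, hz'⟩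
    -- Any competitor contains `y n` in its interior for large `n`. At an index where also `y n ∈
    -- σ`, the competitor is contained in `σ`, and having `d` generators it must be all of `σ`.
    rintro σ' ⟨hσ'1, hσ'2, hσ'3⟩
    obtain ⟨n, hn, hn'⟩ := (hyσ.and_eventually (hpos σ' hσ'2 hσ'3)).exists
    have h1 := hle σ' σ hσ'1 _ hn' hn
    have hσu : C.idx σ = Set.univ := by
      have h2 := C.ncard_idx_of_le h1
      rw [hσ'1, Set.ncard_univ, Nat.card_fin] at h2
      have h3 : {i | toReal (C.basis σ i) ∈ σ'.1} = Set.univ :=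
        Set.eq_of_subset_of_ncard_le (Set.subset_univ _) (by simp [← h2])
      refine Set.eq_univ_of_univ_subset (h3 ▸ ?_)
      exact fun i hi => C.basis_mem_cone.1 (h1 hi)
    refine Subtype.ext (le_antisymm h1 ?_)
    have h2 := C.cone_eq_of_le h1
    have h3 : {i | toReal (C.basis σ i) ∈ σ'.1} = Set.univ := by
      have h2 := C.ncard_idx_of_le h1
      rw [hσ'1, Set.ncard_univ, Nat.card_fin] at h2
      exact Set.eq_of_subset_of_ncard_le (Set.subset_univ _) (by simp [← h2])
    rw [h2, h3, C.cone_eq σ, hσu]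

end Charts

end Fan


/-! ### The Brianchon–Gram identity -/

theorem ind_mul_ind (P Q : Prop) : ind P * ind Q = ind (P ∧ Q) := by
  classical
  simp only [ind_eq_ite]
  by_cases hP : P <;> by_cases hQ : Q <;> simp [hP, hQ]

theorem prod_ind {κ : Type*} (s : Finset κ) (P : κ → Prop) :
    ∏ i ∈ s, ind (P i) = ind (∀ i ∈ s, P i) := by
  classical
  induction s using Finset.induction_on with
  | empty => simp [ind_of]
  | insert k s hk ih =>
    rw [Finset.prod_insert hk, ih, ind_mul_ind]
    simp

namespace Fan

variable {d : ℕ} {Δ : Fan d}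

noncomputable instance fintypeCones (Δ : Fan d) : Fintype Δ.cones := Δ.finite.fintype

/-- The polyhedron with support numbers `a`. -/
def supportPolyhedron (a : Δ.rays → ℝ) : Set (Fin d → ℝ) :=
  {u | ∀ ρ : Δ.rays, u ⬝ᵥ toReal (ρ : Fin d → ℤ) ≤ a ρ}

namespace Charts

variable (C : Δ.Charts)

theorem dotProduct_eq_sum (σ : Δ.cones) (u x : Fin d → ℝ) :
    u ⬝ᵥ x = ∑ i, rcoord (C.basis σ) i x * (u ⬝ᵥ toReal (C.basis σ i)) := by
  conv_lhs => rw [← sum_rcoord_smul (C.basis σ) x]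
  rw [dotProduct_sum]
  simp

-- Each `τ` is charged to the maximal cone given by `existsUnique_cone`. The faces of a maximal `σ`
-- correspond to subsets of its generators, and the signed sum over subsets is the expansion of the
-- product on the right.
open Classical in
theorem sum_cones_eq (hc : Δ.IsComplete) {η : Fin d → ℝ} (hη : C.IsGeneric η)
    (G : (Fin d → ℤ) → Prop) :
    ∑ τ : Δ.cones, (-1) ^ (d - (C.idx τ).ncard) *
        ind (∀ v ∈ Δ.rays, toReal v ∈ τ.1 → G v) =
      ∑ σ : Δ.cones with C.idx σ = Set.univ,
        ∏ i, (ind (G (C.basis σ i)) - ind (0 < rcoord (C.basis σ) i η)) := by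
  have hone : ∀ τ : Δ.cones, ∑ σ : Δ.cones with C.idx σ = Set.univ,
      ind (τ.1 ≤ σ.1 ∧ ∀ i, toReal (C.basis σ i) ∉ τ.1 → 0 < rcoord (C.basis σ) i η) = 1 := by
    intro τ
    obtain ⟨σ, ⟨h1, h2⟩, h3⟩ := C.existsUnique_cone hc hη τ
    rw [Finset.sum_eq_single_of_mem σ (by simpa using h1), ind_of h2]
    intro κ hκ hne
    exact ind_of_not fun h => hne (h3 κ ⟨by simpa using hκ, h⟩)
  calc
    _ = ∑ τ : Δ.cones, ∑ σ : Δ.cones with C.idx σ = Set.univ,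
        ((-1) ^ (d - (C.idx τ).ncard) * ind (∀ v ∈ Δ.rays, toReal v ∈ τ.1 → G v)) *
        ind (τ.1 ≤ σ.1 ∧ ∀ i, toReal (C.basis σ i) ∉ τ.1 → 0 < rcoord (C.basis σ) i η) := by
      refine Finset.sum_congr rfl fun τ _ => ?_
      rw [← Finset.mul_sum, hone, mul_one]
    _ = _ := by
      rw [Finset.sum_comm]
      refine Finset.sum_congr rfl fun σ hσ => ?_
      have hσ' : C.idx σ = Set.univ := by simpa using hσ
      simp only [sub_eq_add_neg]
      rw [Finset.prod_add]
      rw [← Finset.sum_filter_of_ne (p := fun τ : Δ.cones => τ.1 ≤ σ.1)]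
      swap
      · intro τ _ hne
        by_contra h
        exact hne (mul_eq_zero_of_right _ (ind_of_not fun h' => h h'.1))
      refine Finset.sum_bij (fun τ _ => Finset.univ.filter
        fun i => toReal (C.basis σ i) ∈ τ.1) ?_ ?_ ?_ ?_
      · simp
      · intro τ hτ κ hκ h
        have h' : {i | toReal (C.basis σ i) ∈ τ.1} = {i | toReal (C.basis σ i) ∈ κ.1} := by
          ext i
          simpa using Finset.ext_iff.1 h i
        refine Subtype.ext ?_
        rw [C.cone_eq_of_le (Finset.mem_filter.1 hτ).2, h',
          ← C.cone_eq_of_le (Finset.mem_filter.1 hκ).2]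
      · intro T _
        have hT : (T : Set (Fin d)) ⊆ C.idx σ := by simp [hσ']
        refine ⟨⟨_, C.basisCone_mem hT⟩, ?_, ?_⟩
        · rw [Finset.mem_filter]
          refine ⟨Finset.mem_univ _, ?_⟩
          rw [C.cone_eq σ]
          exact (isFaceOf_basisCone hT).le
        · ext i
          simp [basis_mem_basisCone]
      · intro τ hτ
        have hle := (Finset.mem_filter.1 hτ).2
        rw [Finset.prod_neg, prod_ind, prod_ind, C.ncard_idx_of_le hle]
        have hcard : (Finset.univ \ Finset.univ.filter
            fun i => toReal (C.basis σ i) ∈ τ.1).card =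
              d - {i | toReal (C.basis σ i) ∈ τ.1}.ncard := by
          rw [Finset.card_sdiff_of_subset (Finset.subset_univ _), Finset.card_univ,
            Fintype.card_fin, Set.ncard_eq_toFinset_card']
          simp
        rw [hcard, mul_assoc, mul_left_comm (ind _)]
        congr 2
        · have h1 := C.rays_in_face_eq hle
          congr 1
          refine propext ⟨fun h i hi => ?_, fun h v hv hvτ => ?_⟩
          · have hi' : toReal (C.basis σ i) ∈ τ.1 := by simpa using hi
            exact h _ (C.basis_mem_rays (C.basis_mem_cone.1 (hle hi'))) hi'
          · obtain ⟨i, hi, rfl⟩ := h1.subset ⟨hv, hvτ⟩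
            exact h i (by simpa using hi)
        · congr 1
          simp [hle]

/-- Take the point `y` with normal cone `σ`. The constraints tight at `y` are generators of `σ`. If
the one for `i` were slack, `y` could move along the `i`-th dual vector inside the polyhedron,
increasing a functional of its own normal cone. -/
theorem exists_vertex {a : Δ.rays → ℝ} (h : HasNormalFan (supportPolyhedron a) Δ)
    (σ : Δ.cones) : ∃ y ∈ supportPolyhedron a, ∀ i (hi : i ∈ C.idx σ),
      y ⬝ᵥ toReal (C.basis σ i) = a ⟨C.basis σ i, C.basis_mem_rays hi⟩ := by
  obtain ⟨y, hy, hyσ⟩ : ((σ.1 : Set (Fin d → ℝ))) ∈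
      normalCone (supportPolyhedron a) '' supportPolyhedron a := h ▸ ⟨σ.1, σ.2, rfl⟩
  refine ⟨y, hy, fun i hi => le_antisymm (hy ⟨_, C.basis_mem_rays hi⟩) ?_⟩
  by_contra! hlt
  set m : Fin d → ℝ := toReal (dualVec (C.basis σ) i) with hm
  have hmb : ∀ j, m ⬝ᵥ toReal (C.basis σ j) = if j = i then 1 else 0 := fun j => by
    rw [dotProduct_comm, hm, ← rcoord_apply, rcoord_basis]
  have hev : ∀ᶠ ε : ℝ in nhdsWithin 0 (Set.Ioi 0), ∀ ρ : Δ.rays,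
      (y + ε • m) ⬝ᵥ toReal (ρ : Fin d → ℤ) ≤ a ρ := by
    refine Filter.eventually_all.2 fun ρ => ?_
    rcases (hy ρ).eq_or_lt with heq | hlt'
    · have hρσ : toReal (ρ : Fin d → ℤ) ∈ σ.1 := by
        rw [← SetLike.mem_coe, ← hyσ]
        intro z hz
        rw [heq]
        exact hz ρ
      obtain ⟨j, hj, hρj⟩ := C.exists_eq_basis ρ.2 hρσ
      have hji : j ≠ i := by
        rintro rfl
        have : ρ = ⟨_, C.basis_mem_rays hi⟩ := Subtype.ext hρj
        rw [← this] at hlt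
        rw [← hρj] at hlt
        exact hlt.ne heq
      refine Filter.Eventually.of_forall fun ε => ?_
      rw [add_dotProduct, smul_dotProduct, hρj, hmb, if_neg hji, ← hρj]
      simpa using hy ρ
    · have ht : Filter.Tendsto (fun ε : ℝ => (y + ε • m) ⬝ᵥ toReal (ρ : Fin d → ℤ))
          (nhdsWithin 0 (Set.Ioi 0)) (nhds (y ⬝ᵥ toReal (ρ : Fin d → ℤ))) := by
        refine Filter.Tendsto.mono_left ?_ nhdsWithin_le_nhds
        simp only [add_dotProduct, smul_dotProduct, smul_eq_mul]
        have : Continuous fun ε : ℝ => y ⬝ᵥ toReal (ρ : Fin d → ℤ) +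
          ε * (m ⬝ᵥ toReal (ρ : Fin d → ℤ)) := by fun_prop
        simpa using this.tendsto 0
      exact (ht.eventually_lt_const hlt').mono fun ε hε => hε.le
  obtain ⟨ε, hε, hε0⟩ := (hev.and self_mem_nhdsWithin).exists
  have hbσ : toReal (C.basis σ i) ∈ normalCone (supportPolyhedron a) y := by
    rw [hyσ]
    exact C.basis_mem_cone.2 hi
  have := hbσ _ hε
  rw [add_dotProduct, smul_dotProduct, hmb, if_pos rfl, smul_eq_mul, mul_one] at this
  have : (0 : ℝ) < ε := hε0
  linarith

/-- Finitely many nonzero linear forms over an infinite field have a common nonvanishing point.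
Rationality lets `q` also serve as the linear form of the generating functions. -/
theorem exists_rat_generic : ∃ q : Fin d → ℚ, ∀ σ i,
    q ⬝ᵥ (fun k => (dualVec (C.basis σ) i k : ℚ)) ≠ 0 := by
  obtain ⟨q, hq⟩ := Module.Dual.exists_forall_ne_zero_of_forall_exists (K := ℚ)
    (M := Fin d → ℚ) (ι := Δ.cones × Fin d)
    (fun κ => (dotProductBilin ℚ ℚ).flip (fun k => (dualVec (C.basis κ.1) κ.2 k : ℚ))) (by
      rintro ⟨σ, i⟩
      refine ⟨fun k => (C.basis σ i k : ℚ), ?_⟩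
      have := congrArg (Int.cast : ℤ → ℚ) (dotProduct_dualVec_basis (C.basis σ) i i)
      simp only [dotProduct, Int.cast_sum, Int.cast_mul, if_true, Int.cast_one] at this
      simp [dotProduct, this])
  exact ⟨q, fun σ i => by simpa using hq (σ, i)⟩

theorem exists_isGeneric : ∃ η, C.IsGeneric η := by
  obtain ⟨q, hq⟩ := C.exists_rat_generic
  refine ⟨fun k => q k, fun σ i h => hq σ i ?_⟩
  rw [rcoord_apply] at h
  simp only [dotProduct, toReal] at h ⊢
  exact_mod_cast h

/-- The freedom of the generic direction in `sum_cones_eq` is used: inside the polyhedron any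
direction leaves exactly one nonzero term, and outside it a direction close to minus a violated ray
kills every term. -/
theorem sum_cones_eq_ind (hc : Δ.IsComplete) {a : Δ.rays → ℝ}
    (h : HasNormalFan (supportPolyhedron a) Δ) (u : Fin d → ℝ) :
    ∑ τ : Δ.cones, (-1) ^ (d - (C.idx τ).ncard) *
        ind (∀ ρ : Δ.rays, toReal (ρ : Fin d → ℤ) ∈ τ.1 → u ⬝ᵥ toReal (ρ : Fin d → ℤ) ≤ a ρ) =
      ind (u ∈ supportPolyhedron a) := by
  classical
  obtain ⟨η, hη⟩ := C.exists_isGeneric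
  set G : (Fin d → ℤ) → Prop := fun v => ∀ hv : v ∈ Δ.rays, u ⬝ᵥ toReal v ≤ a ⟨v, hv⟩ with hG
  have hGiff : ∀ τ : Δ.cones, (∀ ρ : Δ.rays, toReal (ρ : Fin d → ℤ) ∈ τ.1 →
      u ⬝ᵥ toReal (ρ : Fin d → ℤ) ≤ a ρ) ↔ ∀ v ∈ Δ.rays, toReal v ∈ τ.1 → G v :=
    fun τ => ⟨fun h v hv hvτ _ => h ⟨v, hv⟩ hvτ, fun h ρ hρ => h ρ ρ.2 hρ ρ.2⟩
  simp only [hGiff]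
  by_cases hu : u ∈ supportPolyhedron a
  · rw [ind_of hu, C.sum_cones_eq hc (η := -η) (fun σ i => by simpa using hη σ i)]
    obtain ⟨τ₀, hτ₀⟩ := Δ.nonempty
    have hbot : basisCone (C.basis ⟨τ₀, hτ₀⟩) ∅ ∈ Δ.cones :=
      C.basisCone_mem (σ := ⟨τ₀, hτ₀⟩) (Set.empty_subset _)
    have hbot' : ∀ σ : Δ.cones, ∀ i,
        toReal (C.basis σ i) ∉ basisCone (C.basis ⟨τ₀, hτ₀⟩) ∅ := fun σ i hi =>
      toReal_basis_ne_zero _ i (eq_zero_of_mem_basisCone_empty hi)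
    -- Applied to the zero cone, this says that `η` lies in the interior of exactly one maximal
    -- cone. Only that cone has no vanishing factor.
    obtain ⟨σ, ⟨h1, -, h2⟩, h3⟩ := C.existsUnique_cone hc hη ⟨_, hbot⟩
    have hGt : ∀ v, G v := fun v hv => hu ⟨v, hv⟩
    rw [Finset.sum_eq_single_of_mem σ (by simpa using h1)]
    · refine Finset.prod_eq_one fun i _ => ?_
      have := h2 i (hbot' σ i)
      rw [ind_of (hGt _), ind_of_not, sub_zero]
      rw [map_neg]
      linarith
    · intro κ hκ hne
      have : ∃ i, ¬ 0 < rcoord (C.basis κ) i η := by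
        by_contra! hh
        refine hne (h3 κ ⟨by simpa using hκ, ?_, fun i _ => hh i⟩)
        change basisCone _ ∅ ≤ _
        rw [basisCone, Set.image_empty, PointedCone.hull, Submodule.span_empty]
        exact bot_le
      obtain ⟨i, hi⟩ := this
      refine Finset.prod_eq_zero (Finset.mem_univ i) ?_
      rw [ind_of (hGt _), ind_of, sub_self]
      rw [map_neg]
      have := hη κ i
      exact neg_pos.2 (lt_of_le_of_ne (not_lt.1 hi) this)
  · rw [ind_of_not hu]
    obtain ⟨ρ, hρ⟩ : ∃ ρ : Δ.rays, a ρ < u ⬝ᵥ toReal (ρ : Fin d → ℤ) := by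
      simpa [supportPolyhedron] using hu
    choose y hyP hy using C.exists_vertex h
    -- For small `ε` the direction is generic and `(y σ - u) ⬝ᵥ ξ ε < 0`, since the vertices satisfy
    -- the inequality of `ρ` that `u` violates. A nonzero product over `σ` would force each
    -- coordinate of `ξ ε` to have a sign compatible with that of `(y σ - u) ⬝ᵥ toReal (C.basis σ
    -- i)`, making the pairing nonnegative.
    set ξ : ℝ → Fin d → ℝ := fun ε => toReal (ρ : Fin d → ℤ) + ε • η with hξ
    have hgen : ∀ᶠ ε in nhdsWithin 0 (Set.Ioi 0), C.IsGeneric (ξ ε) := by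
      refine Filter.eventually_all.2 fun σ => Filter.eventually_all.2 fun i => ?_
      have hval : ∀ ε, rcoord (C.basis σ) i (ξ ε) =
          rcoord (C.basis σ) i (toReal (ρ : Fin d → ℤ)) + ε * rcoord (C.basis σ) i η := by
        intro ε; rw [hξ, map_add, map_smul, smul_eq_mul]
      simp only [hval]
      by_cases h0 : rcoord (C.basis σ) i (toReal (ρ : Fin d → ℤ)) = 0
      · filter_upwards [self_mem_nhdsWithin] with ε hε
        rw [h0, zero_add]
        exact mul_ne_zero (ne_of_gt hε) (hη σ i)
      · have hcont : Continuous fun ε : ℝ =>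
          rcoord (C.basis σ) i (toReal (ρ : Fin d → ℤ)) + ε * rcoord (C.basis σ) i η := by fun_prop
        refine (Filter.Tendsto.mono_left (hcont.tendsto 0) nhdsWithin_le_nhds).eventually_ne ?_
        simpa using h0
    have hneg : ∀ᶠ ε in nhdsWithin 0 (Set.Ioi 0), ∀ σ, (y σ - u) ⬝ᵥ ξ ε < 0 := by
      refine Filter.eventually_all.2 fun σ => ?_
      have hcont : Continuous fun ε : ℝ => (y σ - u) ⬝ᵥ ξ ε := by
        simp only [hξ, dotProduct_add, dotProduct_smul, smul_eq_mul]
        fun_prop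
      refine (Filter.Tendsto.mono_left (hcont.tendsto 0) nhdsWithin_le_nhds).eventually_lt_const ?_
      simp only [hξ, zero_smul, add_zero, sub_dotProduct]
      have := hyP σ ρ
      linarith
    obtain ⟨ε, hgen, hneg⟩ := (hgen.and hneg).exists
    rw [C.sum_cones_eq hc (η := -ξ ε) (fun σ i => by simpa using hgen σ i)]
    refine Finset.sum_eq_zero fun σ hσ => ?_
    have hσ' : C.idx σ = Set.univ := by simpa using hσ
    by_contra hne
    rw [← ne_eq, Finset.prod_ne_zero_iff] at hne
    refine (hneg σ).not_ge ?_
    rw [C.dotProduct_eq_sum σ]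
    refine Finset.sum_nonneg fun i _ => ?_
    have hi : i ∈ C.idx σ := by simp [hσ']
    have hfac := hne i (Finset.mem_univ i)
    rw [sub_dotProduct, hy σ i hi]
    have hGi : G (C.basis σ i) ↔
        u ⬝ᵥ toReal (C.basis σ i) ≤ a ⟨_, C.basis_mem_rays hi⟩ :=
      ⟨fun h => h _, fun h _ => h⟩
    by_cases hg : G (C.basis σ i)
    · have h1 : ¬ 0 < rcoord (C.basis σ) i (-ξ ε) := fun h => hfac (by
        rw [ind_of hg, ind_of h, sub_self])
      rw [map_neg, neg_pos, not_lt] at h1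
      exact mul_nonneg h1 (sub_nonneg.2 (hGi.1 hg))
    · have h1 : 0 < rcoord (C.basis σ) i (-ξ ε) := by
        by_contra h
        exact hfac (by rw [ind_of_not hg, ind_of_not h, sub_self])
      rw [map_neg, neg_pos] at h1
      rw [hGi, not_le] at hg
      exact mul_nonneg_of_nonpos_of_nonpos h1.le (by linarith)

/-- By completeness `x` is a nonnegative combination of ray generators, each of which is bounded on
the polyhedron. -/
theorem exists_dotProduct_le (C : Δ.Charts) (hc : Δ.IsComplete) (a : Δ.rays → ℝ) (x : Fin d → ℝ) :
    ∃ c : ℝ, ∀ u ∈ supportPolyhedron a, u ⬝ᵥ x ≤ c := by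
  classical
  obtain ⟨σ, hx⟩ : ∃ σ : Δ.cones, x ∈ σ.1 := by simpa using hc x
  rw [C.cone_eq σ, mem_basisCone] at hx
  refine ⟨∑ i, rcoord (C.basis σ) i x * (if h : i ∈ C.idx σ then
    a ⟨_, C.basis_mem_rays h⟩ else 0), fun u hu => ?_⟩
  rw [C.dotProduct_eq_sum σ]
  refine Finset.sum_le_sum fun i _ => ?_
  split_ifs with h
  · exact mul_le_mul_of_nonneg_left (hu ⟨_, C.basis_mem_rays h⟩) (hx i).1
  · rw [(hx i).2 h, zero_mul, zero_mul]

theorem finite_lattice_points (C : Δ.Charts) (hc : Δ.IsComplete) (a : Δ.rays → ℝ) :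
    {u : Fin d → ℤ | toReal u ∈ supportPolyhedron a}.Finite := by
  choose c hcp using fun k : Fin d => C.exists_dotProduct_le hc a (Pi.single k 1)
  choose c' hcp' using fun k : Fin d => C.exists_dotProduct_le hc a (-Pi.single k 1)
  refine (Set.finite_Icc (fun k => ⌈-c' k⌉) (fun k => ⌊c k⌋)).subset fun u hu => ?_
  refine ⟨fun k => Int.ceil_le.2 ?_, fun k => Int.le_floor.2 ?_⟩
  · have := hcp' k _ hu
    simp [toReal] at this
    linarith
  · simpa [toReal] using hcp k _ hu

end Charts

end Fan


/-! ### Polynomiality of lattice point counts -/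

namespace Fan

namespace Charts

variable {d : ℕ} {Δ : Fan d} (C : Δ.Charts)

/-- The linear form on the lattice given by a rational vector. -/
def ratForm (q : Fin d → ℚ) : (Fin d → ℤ) →+ ℚ where
  toFun u := q ⬝ᵥ fun k => (u k : ℚ)
  map_zero' := by simp [dotProduct]
  map_add' u v := by simp [dotProduct, mul_add, Finset.sum_add_distrib]

/-- A full-dimensional `τ` gives an orthant in dual coordinates, and `ℓ` is the value of the linear
form at its apex. Otherwise the tangent cone is invariant under the dual vector of a missing
generator. -/
theorem exists_hasGenFun_cone {q : Fin d → ℚ}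
    (hq : ∀ σ i, q ⬝ᵥ (fun k => (dualVec (C.basis σ) i k : ℚ)) ≠ 0) (τ : Δ.cones) :
    ∃ (ℓ : MvPolynomial Δ.rays ℚ) (U : PowerSeries ℚ), ℓ.totalDegree ≤ 1 ∧
      ∀ a : Δ.rays → ℤ, HasGenFun (ratForm q) d (fun u : Fin d → ℤ =>
        ind (∀ ρ : Δ.rays, toReal (ρ : Fin d → ℤ) ∈ τ.1 → u ⬝ᵥ (ρ : Fin d → ℤ) ≤ a ρ))
        (expSeries (MvPolynomial.eval (fun ρ => (a ρ : ℚ)) ℓ) * U) := by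
  classical
  by_cases hτ : C.idx τ = Set.univ
  · have hi : ∀ i, i ∈ C.idx τ := fun i => by simp [hτ]
    set r : Fin d → Δ.rays := fun i => ⟨_, C.basis_mem_rays (hi i)⟩ with hr
    let p : Fin d → (Fin d → ℤ) →+ ℤ := fun i =>
      { toFun := fun u => u ⬝ᵥ C.basis τ i
        map_zero' := by simp
        map_add' := by simp [add_dotProduct] }
    obtain ⟨U, hU⟩ := exists_hasGenFun_orthant (ξ := ratForm q) (p := p)
      (m := dualVec (C.basis τ))
      (fun i => by
        change dualVec (C.basis τ) i ⬝ᵥ C.basis τ i = 1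
        rw [dotProduct_comm, dotProduct_dualVec_basis, if_pos rfl])
      (fun i j hij => by
        change dualVec (C.basis τ) j ⬝ᵥ C.basis τ i = 0
        rw [dotProduct_comm, dotProduct_dualVec_basis, if_neg hij])
      (fun u v huv => by
        refine toReal_injective ?_
        have hz : ∀ x, toReal u ⬝ᵥ x = toReal v ⬝ᵥ x := fun x => by
          rw [C.dotProduct_eq_sum τ, C.dotProduct_eq_sum τ]
          refine Finset.sum_congr rfl fun i _ => ?_
          have h1 : u ⬝ᵥ C.basis τ i = v ⬝ᵥ C.basis τ i := huv i
          rw [toReal_dotProduct, toReal_dotProduct, h1]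
        funext k
        simpa using hz (Pi.single k 1))
      (fun i => hq τ i)
    refine ⟨∑ i, MvPolynomial.X (r i) * MvPolynomial.C (ratForm q (dualVec (C.basis τ) i)), U,
      MvPolynomial.totalDegree_finsetSum_le fun i _ => ?_, fun a => ?_⟩
    · refine (MvPolynomial.totalDegree_mul _ _).trans ?_
      simp
    · have h1 := hU fun i => a (r i)
      rw [Fintype.card_fin] at h1
      convert h1 using 2
      · congr 1
        refine propext ⟨fun h i => h (r i) (C.basis_mem_cone.2 (hi i)), fun h ρ hρ => ?_⟩
        obtain ⟨i, _, hρi⟩ := C.exists_eq_basis ρ.2 hρ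
        obtain rfl : ρ = r i := Subtype.ext hρi
        exact h i
      · simp
  · obtain ⟨j, hj⟩ := (Set.ne_univ_iff_exists_notMem _).1 hτ
    refine ⟨0, 0, by simp, fun a => ?_⟩
    rw [mul_zero]
    refine hasGenFun_of_periodic (m := dualVec (C.basis τ) j) (hq τ j) fun u => ?_
    congr 1
    refine propext (forall_congr' fun ρ => imp_congr_right fun hρ => ?_)
    obtain ⟨i, hi, hρi⟩ := C.exists_eq_basis ρ.2 hρ
    have hij : i ≠ j := fun h => hj (h ▸ hi)
    rw [hρi, sub_dotProduct, dotProduct_comm (dualVec _ _), dotProduct_dualVec_basis,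
      if_neg hij, sub_zero]

/-- The number of lattice points of a polyhedron with outer normal fan a given smooth complete fan
is a polynomial in the support numbers. -/
theorem exists_polynomial_ncard (C : Δ.Charts) (hc : Δ.IsComplete) :
    ∃ p : MvPolynomial Δ.rays ℚ, p.totalDegree ≤ d ∧ ∀ a : Δ.rays → ℤ,
      HasNormalFan (supportPolyhedron fun ρ => (a ρ : ℝ)) Δ →
      ({u : Fin d → ℤ | toReal u ∈ supportPolyhedron fun ρ => (a ρ : ℝ)}.ncard : ℚ) =
        MvPolynomial.eval (fun ρ => (a ρ : ℚ)) p := by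
  classical
  obtain ⟨q, hq⟩ := C.exists_rat_generic
  choose ℓ U hℓ hgen using C.exists_hasGenFun_cone hq
  -- This is the coefficient of `X ^ d` in the signed sum of the `exp (ℓ τ X) * U τ`. The generating
  -- function was multiplied by `X ^ d`, so it equals the constant term of `expSum`, which is the
  -- number of points.
  refine ⟨∑ τ : Δ.cones, ∑ k ∈ Finset.HasAntidiagonal.antidiagonal d,
    MvPolynomial.C ((-1) ^ (d - (C.idx τ).ncard) * ((k.1.factorial : ℚ)⁻¹ *
      PowerSeries.coeff k.2 (U τ))) * ℓ τ ^ k.1, ?_, fun a ha => ?_⟩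
  · refine MvPolynomial.totalDegree_finsetSum_le fun τ _ =>
      MvPolynomial.totalDegree_finsetSum_le fun k hk => ?_
    refine (MvPolynomial.totalDegree_mul _ _).trans ?_
    rw [MvPolynomial.totalDegree_C, zero_add]
    refine (MvPolynomial.totalDegree_pow _ _).trans ?_
    have h1 := Nat.mul_le_mul_left k.1 (hℓ τ)
    have h2 := Finset.HasAntidiagonal.mem_antidiagonal.1 hk
    omega
  · set a' : Δ.rays → ℝ := fun ρ => (a ρ : ℝ) with ha'
    have hfin := C.finite_lattice_points hc a'
    set F : (Fin d → ℤ) →₀ ℚ := Finsupp.onFinset hfin.toFinset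
      (fun u => ind (toReal u ∈ supportPolyhedron a')) (fun u hu => by
        rw [Set.Finite.mem_toFinset]
        by_contra h
        exact hu (ind_of_not h)) with hF
    have hFsum : F.sum (fun _ c => c) =
        ({u : Fin d → ℤ | toReal u ∈ supportPolyhedron a'}.ncard : ℚ) := by
      rw [hF, Finsupp.onFinset_sum _ fun _ => rfl, Set.ncard_eq_toFinset_card _ hfin,
        Finset.card_eq_sum_ones, Nat.cast_sum]
      refine Finset.sum_congr rfl fun u hu => ?_
      rw [Set.Finite.mem_toFinset] at hu
      rw [ind_of (show toReal u ∈ supportPolyhedron a' from hu), Nat.cast_one]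
    have hFeq : (⇑F : (Fin d → ℤ) → ℚ) = ∑ τ : Δ.cones, ((-1 : ℚ) ^ (d - (C.idx τ).ncard)) •
        fun u : Fin d → ℤ => ind (∀ ρ : Δ.rays, toReal (ρ : Fin d → ℤ) ∈ τ.1 →
          u ⬝ᵥ (ρ : Fin d → ℤ) ≤ a ρ) := by
      funext u
      rw [hF, Finsupp.onFinset_apply, ← C.sum_cones_eq_ind hc ha, Finset.sum_apply]
      refine Finset.sum_congr rfl fun τ _ => ?_
      rw [Pi.smul_apply, smul_eq_mul]
      congr 2
      refine propext (forall_congr' fun ρ => imp_congr_right fun hρ => ?_)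
      rw [toReal_dotProduct, ha', Int.cast_le]
    have hgf : HasGenFun (ratForm q) d (⇑F : (Fin d → ℤ) → ℚ) _ :=
      hFeq ▸ HasGenFun.sum Finset.univ fun τ _ => (hgen τ a).smul _
    have hcoeff := congrArg (PowerSeries.coeff d) hgf.eq_of_finsupp
    rw [PowerSeries.coeff_X_pow_mul', if_pos le_rfl, Nat.sub_self, coeff_zero_expSum,
      hFsum] at hcoeff
    rw [hcoeff, map_sum, map_sum]
    refine Finset.sum_congr rfl fun τ _ => ?_
    rw [map_smul, smul_eq_mul, PowerSeries.coeff_mul, Finset.mul_sum, map_sum]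
    refine Finset.sum_congr rfl fun k _ => ?_
    rw [coeff_expSeries, map_mul, map_pow, MvPolynomial.eval_C]
    ring

end Charts

end Fan


/-! ### Invariance under positive scaling -/

theorem HasNormalFan.smul {d : ℕ} {Δ : Fan d} {P Q : Set (Fin d → ℝ)} (h : HasNormalFan P Δ)
    {c : ℝ} (hc : 0 < c) (hQ : ∀ u, c • u ∈ Q ↔ u ∈ P) : HasNormalFan Q Δ := by
  have hQP : Q = (fun u => c • u) '' P := by
    ext u
    constructor
    · intro hu
      refine ⟨c⁻¹ • u, (hQ _).1 (by rwa [smul_inv_smul₀ hc.ne']), ?_⟩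
      exact smul_inv_smul₀ hc.ne' u
    · rintro ⟨v, hv, rfl⟩
      exact (hQ v).2 hv
  have hcone : ∀ y, normalCone Q (c • y) = normalCone P y := by
    intro y
    ext w
    constructor
    · intro hw z hz
      have := hw (c • z) ((hQ z).2 hz)
      rw [smul_dotProduct, smul_dotProduct, smul_eq_mul, smul_eq_mul] at this
      exact le_of_mul_le_mul_left this hc
    · intro hw z hz
      rw [hQP] at hz
      obtain ⟨v, hv, rfl⟩ := hz
      simp only [smul_dotProduct, smul_eq_mul]
      exact mul_le_mul_of_nonneg_left (hw v hv) hc.le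
  rw [HasNormalFan, ← h]
  conv_lhs => rw [hQP, Set.image_image]
  rw [← hQP]
  exact Set.image_congr fun y _ => hcone y

theorem smul_mem_bergman {α : Type*} {M : Matroid α} {w : α → ℝ} (hw : w ∈ bergman M) {c : ℝ}
    (hc : 0 ≤ c) : c • w ∈ bergman M := by
  intro C hC
  obtain ⟨i, hi, j, hj, hij, h⟩ := hw C hC
  exact ⟨i, hi, j, hj, hij, fun k hk => ⟨mul_le_mul_of_nonneg_left (h k hk).1 hc,
    mul_le_mul_of_nonneg_left (h k hk).2 hc⟩⟩

theorem smul_mem_normalCone {ι : Type*} [Fintype ι] {P : Set (ι → ℝ)} {y w : ι → ℝ}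
    (hw : w ∈ normalCone P y) {c : ℝ} (hc : 0 ≤ c) : c • w ∈ normalCone P y := by
  intro z hz
  rw [dotProduct_smul, dotProduct_smul]
  exact mul_le_mul_of_nonneg_left (hw z hz) hc

theorem smul_mem_ampleDiagrams {d : ℕ} {Δ : Fan d} {α : Type*} [Fintype α] {M : Matroid α}
    {D : Matrix Δ.rays α ℝ} (hD : D ∈ ampleDiagrams Δ M) {c : ℝ} (hc : 0 < c) :
    c • D ∈ ampleDiagrams Δ M := by
  refine ⟨⟨fun ρ => smul_mem_bergman (hD.1.1 ρ) hc.le, fun σ hσ => ?_⟩, fun F hF hF' => ?_⟩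
  · obtain ⟨B, hB, h⟩ := hD.1.2 σ hσ
    exact ⟨B, hB, fun ρ hρ => ⟨smul_mem_bergman (h ρ hρ).1 hc.le,
      smul_mem_normalCone (h ρ hρ).2 hc.le⟩⟩
  · refine (hD.2 F hF hF').smul hc fun u => ?_
    simp only [flatPolyhedron, Set.mem_iInter, polyhedron, Set.mem_ofPred_eq, smul_dotProduct,
      Matrix.smul_apply, smul_eq_mul, mul_le_mul_iff_right₀ hc]

/-! ### Flats from Bergman vectors, and Möbius inversion -/

section MatroidRank

variable {α : Type*} {M : Matroid α}

/-- If `f` is in the closure but not in the set, some circuit consists of `f` and elements of the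
set. Its minimum is attained at some `k ≠ f`, so `w f ≥ w k ≥ r`, a contradiction. -/
theorem isFlat_superlevel (hE : M.E = Set.univ) {w : α → ℝ} (hw : w ∈ bergman M) (r : ℝ) :
    M.IsFlat {e | r ≤ w e} := by
  rw [Matroid.isFlat_iff_closure_eq]
  refine Set.Subset.antisymm (fun f hf => ?_) (M.subset_closure _ (by simp [hE]))
  by_contra hfr
  obtain ⟨C, hC, hcirc, hfC⟩ := Matroid.exists_isCircuit_of_mem_closure hf hfr
  obtain ⟨i, hi, j, hj, hij, hmin⟩ := hw C hcirc
  have hne : ∃ k ∈ C, k ≠ f ∧ ∀ l ∈ C, w k ≤ w l := by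
    by_cases hif : i = f
    · exact ⟨j, hj, fun h => hij (hif.trans h.symm), fun l hl => (hmin l hl).2⟩
    · exact ⟨i, hi, hif, fun l hl => (hmin l hl).1⟩
  obtain ⟨k, hk, hkf, hkmin⟩ := hne
  have hrk : r ≤ w k := (Set.mem_insert_iff.1 (hC hk)).resolve_left hkf
  exact hfr (hrk.trans (hkmin f hfC))

/-- Möbius inversion: `c x` is defined by well-founded recursion as what the elements below `x`
leave over. -/
theorem exists_eq_sum_le {P : Type*} [PartialOrder P] [Fintype P] (r : P → ℚ) :
    ∃ c : P → ℚ, ∀ x, r x = ∑ y, c y * ind (y ≤ x) := by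
  classical
  let c : P → ℚ := (wellFounded_lt (α := P)).fix fun x ih =>
    r x - ∑ y : {y // y < x}, ih y.1 y.2
  have hcx : ∀ x, c x = r x - ∑ y : {y // y < x}, c y.1 := fun x =>
    (wellFounded_lt (α := P)).fix_eq _ x
  refine ⟨c, fun x => ?_⟩
  have h1 : ∑ y, c y * ind (y ≤ x) = ∑ y with y ≤ x, c y := by
    rw [Finset.sum_filter]
    refine Finset.sum_congr rfl fun y _ => ?_
    rw [ind_eq_ite]
    split_ifs <;> simp
  have h2 : (Finset.univ.filter (· ≤ x)) = insert x (Finset.univ.filter (· < x)) := by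
    ext y
    simp [le_iff_eq_or_lt]
  rw [h1, h2, Finset.sum_insert (by simp), hcx x,
    Finset.sum_subtype (p := fun y => y < x) (Finset.univ.filter (· < x)) (by simp)]
  ring

end MatroidRank

/-! ### Global sections as a combination of lattice point counts -/

section Sections

variable {d : ℕ} {Δ : Fan d} {α : Type*} {M : Matroid α} {D : Matrix Δ.rays α ℝ}

/-- The set of ground set elements `e` with `u ∈ P_{D,e}`. -/
def sectionFlat (D : Matrix Δ.rays α ℝ) (u : Fin d → ℝ) : Set α :=
  ⋂ ρ : Δ.rays, klyachko D ρ (u ⬝ᵥ toReal (ρ : Fin d → ℤ))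

theorem mem_sectionFlat {u : Fin d → ℝ} {e : α} :
    e ∈ sectionFlat D u ↔ u ∈ Fan.supportPolyhedron fun ρ => D ρ e := by
  simp [sectionFlat, klyachko, Fan.supportPolyhedron]

theorem mem_flatPolyhedron {u : Fin d → ℝ} {F : Set α} :
    u ∈ flatPolyhedron D F ↔ F ⊆ sectionFlat D u := by
  simp only [flatPolyhedron, Set.mem_iInter]
  exact forall₂_congr fun e _ => mem_sectionFlat.symm

theorem isFlat_sectionFlat (hE : M.E = Set.univ) (hD : ∀ ρ, D ρ ∈ bergman M) (u : Fin d → ℝ) :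
    M.IsFlat (sectionFlat D u) := by
  rcases isEmpty_or_nonempty Δ.rays with h | h
  · rw [sectionFlat, Set.iInter_of_empty, ← hE]
    exact M.ground_isFlat
  · exact Matroid.IsFlat.iInter fun ρ => isFlat_superlevel hE (hD ρ) _

theorem flatPolyhedron_eq {F : Set α} {sel : Δ.rays → α} (hsel : ∀ ρ, sel ρ ∈ F)
    (hmin : ∀ ρ, ∀ e ∈ F, D ρ (sel ρ) ≤ D ρ e) :
    flatPolyhedron D F = Fan.supportPolyhedron fun ρ => D ρ (sel ρ) := by
  ext u
  simp only [flatPolyhedron, Set.mem_iInter, polyhedron, Set.mem_ofPred_eq, Fan.supportPolyhedron]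
  exact ⟨fun h ρ => h _ (hsel ρ) ρ, fun h e he ρ => (h ρ).trans (hmin ρ e he)⟩

theorem nonempty_sectionFlat_of_h0_ne_zero {u : Fin d → ℝ} (h : h0 M D u ≠ 0) :
    (sectionFlat D u).Nonempty := by
  rw [Set.nonempty_iff_ne_empty]
  intro h'
  refine h ?_
  change (M.eRk (sectionFlat D u)).toNat = 0
  rw [h', Matroid.eRk_empty]
  rfl

variable [Fintype α]

theorem finite_h0_ne_zero (C : Δ.Charts) (hc : Δ.IsComplete) :
    {u : Fin d → ℤ | h0 M D (toReal u) ≠ 0}.Finite := by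
  refine (Set.finite_iUnion fun e : α => C.finite_lattice_points hc fun ρ => D ρ e).subset
    fun u hu => ?_
  obtain ⟨e, he⟩ := nonempty_sectionFlat_of_h0_ne_zero hu
  exact Set.mem_iUnion.2 ⟨e, mem_sectionFlat.1 he⟩

/-- The nonempty flats of a matroid. -/
abbrev NonemptyFlat (M : Matroid α) : Type _ := {F : Set α // M.IsFlat F ∧ F.Nonempty}

noncomputable instance (M : Matroid α) : Fintype (NonemptyFlat M) := Fintype.ofFinite _

theorem exists_totalSections_eq_sum (C : Δ.Charts) (hc : Δ.IsComplete) (hE : M.E = Set.univ) :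
    ∃ c : NonemptyFlat M → ℚ, ∀ D : Matrix Δ.rays α ℝ, (∀ ρ, D ρ ∈ bergman M) →
      (totalSections M D : ℚ) =
        ∑ F, c F * ({u : Fin d → ℤ | toReal u ∈ flatPolyhedron D F.1}.ncard : ℚ) := by
  classical
  obtain ⟨c, hcr⟩ := exists_eq_sum_le fun F : NonemptyFlat M => ((M.eRk F.1).toNat : ℚ)
  refine ⟨c, fun D hD => ?_⟩
  have hh0 : ∀ u, (h0 M D u : ℚ) = ∑ F, c F * ind (u ∈ flatPolyhedron D F.1) := by
    intro u
    simp only [mem_flatPolyhedron]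
    by_cases hne : (sectionFlat D u).Nonempty
    · exact hcr ⟨_, isFlat_sectionFlat hE hD u, hne⟩
    · have h1 : h0 M D u = 0 := by
        by_contra h
        exact hne (nonempty_sectionFlat_of_h0_ne_zero h)
      rw [h1, Nat.cast_zero, Finset.sum_eq_zero]
      intro F _
      rw [ind_of_not fun h => hne (F.2.2.mono h), mul_zero]
  have hfin :
      (⋃ e : α, {u : Fin d → ℤ | toReal u ∈ Fan.supportPolyhedron fun ρ => D ρ e}).Finite :=
    Set.finite_iUnion fun e : α => C.finite_lattice_points hc fun ρ => D ρ e
  rw [totalSections, finsum_eq_sum_of_support_subset (s := hfin.toFinset), Nat.cast_sum]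
  · simp only [hh0]
    rw [Finset.sum_comm]
    refine Finset.sum_congr rfl fun F _ => ?_
    rw [← Finset.mul_sum]
    congr 1
    have hsub : {u : Fin d → ℤ | toReal u ∈ flatPolyhedron D F.1} =
        ((hfin.toFinset.filter fun u => toReal u ∈ flatPolyhedron D F.1 : Finset _) :
          Set (Fin d → ℤ)) := by
      ext u
      simp only [Set.mem_ofPred_eq, Finset.coe_filter, Set.Finite.mem_toFinset, Set.mem_iUnion]
      refine ⟨fun h => ⟨?_, h⟩, fun h => h.2⟩
      obtain ⟨e, he⟩ := F.2.2
      exact ⟨e, mem_sectionFlat.1 (mem_flatPolyhedron.1 h he)⟩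
    rw [hsub, Set.ncard_coe_finset, Finset.card_filter, Nat.cast_sum]
    refine Finset.sum_congr rfl fun u _ => ?_
    rw [ind_eq_ite]
    split_ifs <;> simp
  · intro u hu
    obtain ⟨e, he⟩ := nonempty_sectionFlat_of_h0_ne_zero hu
    simp only [Set.Finite.coe_toFinset, Set.mem_iUnion]
    exact ⟨e, mem_sectionFlat.1 he⟩

/-- At a lattice point of the polyhedron the section flat contains an element of `F`, which is not a
loop, so `h0` is at least one. -/
theorem ncard_le_totalSections (C : Δ.Charts) (hc : Δ.IsComplete) (hE : M.E = Set.univ)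
    [M.Loopless] {F : Set α} (hF : F.Nonempty) :
    {u : Fin d → ℤ | toReal u ∈ flatPolyhedron D F}.ncard ≤ totalSections M D := by
  classical
  have hfin := finite_h0_ne_zero (M := M) (D := D) C hc
  rw [totalSections, finsum_eq_sum_of_support_subset (s := hfin.toFinset) _ (by
      intro u hu; simpa using hu), ← Set.ncard_image_of_injective _ Function.injective_id]
  have hsub : id '' {u : Fin d → ℤ | toReal u ∈ flatPolyhedron D F} ⊆
      {u : Fin d → ℤ | h0 M D (toReal u) ≠ 0} := by
    rw [Set.image_id]
    intro u hu h
    obtain ⟨e, he⟩ := hF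
    have heu := mem_flatPolyhedron.1 hu he
    change (M.eRk (sectionFlat D (toReal u))).toNat = 0 at h
    have hne : M.eRk (sectionFlat D (toReal u)) ≠ ⊤ := by
      rw [Matroid.eRk_ne_top_iff]
      exact M.isRkFinite_of_finite (Set.toFinite _)
    have h0' : M.eRk (sectionFlat D (toReal u)) = 0 :=
      ((ENat.toNat_eq_zero).1 h).resolve_right hne
    rw [Matroid.eRk_eq_zero_iff (by simp [hE])] at h0'
    have := h0' heu
    simp at this
  refine (Set.ncard_le_ncard hsub hfin).trans ?_
  rw [Set.ncard_eq_toFinset_card _ hfin, Finset.card_eq_sum_ones]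
  refine Finset.sum_le_sum fun u hu => ?_
  rw [Set.Finite.mem_toFinset] at hu
  exact Nat.one_le_iff_ne_zero.2 hu

end Sections

/-! ### Lower bounds for growth and degree -/

section Growth

variable {d : ℕ} {Δ : Fan d}

/-- The point with normal cone zero is interior. With `K` large and `w` the rounding of `K y`, the
dilate by `n K` contains the lattice cube `n w + [0, n)ᵈ`. -/
theorem Fan.Charts.exists_pow_le_ncard (C : Δ.Charts) {a : Δ.rays → ℝ}
    (hc : Δ.IsComplete) (ha : HasNormalFan (Fan.supportPolyhedron a) Δ) :
    ∃ K : ℕ, 0 < K ∧ ∀ n : ℕ, n ^ d ≤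
      {u : Fin d → ℤ |
        toReal u ∈ Fan.supportPolyhedron fun ρ => ((n * K : ℕ) : ℝ) * a ρ}.ncard := by
  classical
  obtain ⟨τ₀, hτ₀⟩ := Δ.nonempty
  have hbot : basisCone (C.basis ⟨τ₀, hτ₀⟩) ∅ ∈ Δ.cones :=
    C.basisCone_mem (σ := ⟨τ₀, hτ₀⟩) (Set.empty_subset _)
  obtain ⟨y, hy, hyσ⟩ : (basisCone (C.basis ⟨τ₀, hτ₀⟩) ∅ : Set (Fin d → ℝ)) ∈
      normalCone (Fan.supportPolyhedron a) '' Fan.supportPolyhedron a := ha ▸ ⟨_, hbot, rfl⟩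
  have hlt : ∀ ρ : Δ.rays, y ⬝ᵥ toReal (ρ : Fin d → ℤ) < a ρ := by
    intro ρ
    refine lt_of_le_of_ne (hy ρ) fun heq => ?_
    have hmem : toReal (ρ : Fin d → ℤ) ∈ basisCone (C.basis ⟨τ₀, hτ₀⟩) ∅ := by
      rw [← SetLike.mem_coe, ← hyσ]
      intro z hz
      rw [heq]
      exact hz ρ
    obtain ⟨i, hi, -⟩ := C.exists_eq_basis (σ := ⟨_, hbot⟩) ρ.2 hmem
    exact toReal_basis_ne_zero _ i (eq_zero_of_mem_basisCone_empty (C.basis_mem_cone.2 hi))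
  -- The factor `2` pays once for the rounding error `w - K y` and once for the offset within the
  -- cube.
  have hK : ∀ᶠ K : ℕ in Filter.atTop, ∀ ρ : Δ.rays,
      2 * ∑ k, |toReal (ρ : Fin d → ℤ) k| ≤
        (K : ℝ) * (a ρ - y ⬝ᵥ toReal (ρ : Fin d → ℤ)) :=
    Filter.eventually_all.2 fun ρ => (tendsto_natCast_atTop_atTop.atTop_mul_const
      (sub_pos.2 (hlt ρ))).eventually_ge_atTop _
  obtain ⟨K, hK, hK0⟩ := (hK.and (Filter.eventually_gt_atTop 0)).exists
  refine ⟨K, hK0, fun n => ?_⟩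
  set w : Fin d → ℤ := fun k => ⌊(K : ℝ) * y k⌋ with hw
  have hfin := C.finite_lattice_points hc fun ρ => ((n * K : ℕ) : ℝ) * a ρ
  have hcard : (Fintype.piFinset fun _ : Fin d => Finset.Ico (0 : ℤ) n).card = n ^ d := by
    simp
  rw [← hcard, ← Set.ncard_coe_finset, ← Set.ncard_image_of_injective _
    (add_right_injective ((n : ℤ) • w))]
  refine Set.ncard_le_ncard ?_ hfin
  rintro _ ⟨z, hz, rfl⟩ ρ
  rw [Finset.mem_coe, Fintype.mem_piFinset] at hz
  have hz' : ∀ k, |(z k : ℝ)| ≤ n := fun k => by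
    have := Finset.mem_Ico.1 (hz k)
    rw [abs_of_nonneg (by exact_mod_cast this.1)]
    exact_mod_cast this.2.le
  have hw' : ∀ k, |(w k : ℝ) - K * y k| ≤ 1 := fun k => by
    have h1 := Int.floor_le ((K : ℝ) * y k)
    have h2 := Int.lt_floor_add_one ((K : ℝ) * y k)
    rw [abs_le]
    constructor <;> simp only [hw] <;> linarith
  have hn : (0 : ℝ) ≤ n := Nat.cast_nonneg n
  have hsum : toReal ((n : ℤ) • w + z) ⬝ᵥ toReal (ρ : Fin d → ℤ) ≤
      n * (K * (y ⬝ᵥ toReal (ρ : Fin d → ℤ))) +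
        n * (2 * ∑ k, |toReal (ρ : Fin d → ℤ) k|) := by
    simp only [dotProduct, Finset.mul_sum, ← Finset.sum_add_distrib]
    refine Finset.sum_le_sum fun k _ => ?_
    set t := toReal (ρ : Fin d → ℤ) k
    have e : toReal ((n : ℤ) • w + z) k = n * (w k : ℝ) + z k := by simp [toReal]
    have h1 : ((w k : ℝ) - K * y k) * t ≤ |t| := by
      refine (le_abs_self _).trans ?_
      rw [abs_mul]
      exact mul_le_of_le_one_left (abs_nonneg _) (hw' k)
    have h2 : (z k : ℝ) * t ≤ n * |t| := by
      refine (le_abs_self _).trans ?_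
      rw [abs_mul]
      exact mul_le_mul_of_nonneg_right (hz' k) (abs_nonneg _)
    have h3 := mul_le_mul_of_nonneg_left h1 hn
    rw [e]
    nlinarith
  refine hsum.trans ?_
  have := mul_le_mul_of_nonneg_left (hK ρ) hn
  push_cast
  nlinarith

theorem natDegree_aeval_le {ι : Type*} (p : MvPolynomial ι ℚ) (g : ι → Polynomial ℚ)
    (hg : ∀ i, (g i).natDegree ≤ 1) : (MvPolynomial.aeval g p).natDegree ≤ p.totalDegree := by
  rw [MvPolynomial.aeval_def, MvPolynomial.eval₂_eq]
  refine Polynomial.natDegree_sum_le_of_forall_le _ _ fun m hm => ?_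
  refine (Polynomial.natDegree_C_mul_le _ _).trans ((Polynomial.natDegree_prod_le _ _).trans ?_)
  refine le_trans ?_ (MvPolynomial.le_totalDegree hm)
  refine Finset.sum_le_sum fun i _ => Polynomial.natDegree_pow_le.trans ?_
  exact (Nat.mul_le_mul_left _ (hg i)).trans (mul_one _).le

/-- Restrict `p` to the line through `x` to get a univariate `q`. If its degree were below `d`, then
`X ^ d - q` would be monic of positive degree and eventually positive. -/
theorem le_totalDegree_of_pow_le {ι : Type*} (p : MvPolynomial ι ℚ) (x : ι → ℚ) {d : ℕ}
    (h : ∀ n : ℕ, 0 < n → (n : ℚ) ^ d ≤ MvPolynomial.eval (fun i => (n : ℚ) * x i) p) :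
    d ≤ p.totalDegree := by
  by_contra! hlt
  set q : Polynomial ℚ := MvPolynomial.aeval (fun i => Polynomial.X * Polynomial.C (x i)) p
  have hq : q.natDegree < d := (natDegree_aeval_le p _ fun i =>
    (Polynomial.natDegree_mul_C_le _ _).trans Polynomial.natDegree_X_le).trans_lt hlt
  have heval : ∀ n : ℕ, q.eval (n : ℚ) = MvPolynomial.eval (fun i => (n : ℚ) * x i) p := by
    intro n
    have := MvPolynomial.map_aeval (fun i => Polynomial.X * Polynomial.C (x i))
      (Polynomial.evalRingHom (n : ℚ)) p
    rw [← Polynomial.coe_evalRingHom, this, MvPolynomial.eval, MvPolynomial.coe_eval₂Hom]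
    congr 1
    · exact Subsingleton.elim _ _
    · funext i; simp; ring
  have hq' : q.degree < d := Polynomial.degree_lt_iff_coeff_zero _ _ |>.2 fun k hk =>
    Polynomial.coeff_eq_zero_of_natDegree_lt (hq.trans_le hk)
  have hmonic : (Polynomial.X ^ d - q).Monic := Polynomial.monic_X_pow_sub hq'
  have hdeg : (Polynomial.X ^ d - q).degree = (d : WithBot ℕ) := by
    rw [Polynomial.degree_sub_eq_left_of_degree_lt] <;> rw [Polynomial.degree_X_pow]
    exact hq'
  have htend := Polynomial.tendsto_atTop_of_leadingCoeff_nonneg (Polynomial.X ^ d - q)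
    (by rw [hdeg]; exact_mod_cast (Nat.zero_le _).trans_lt hlt)
    (by rw [hmonic.leadingCoeff]; exact zero_le_one)
  obtain ⟨n, hn, hn0⟩ := (((htend.comp tendsto_natCast_atTop_atTop).eventually_gt_atTop
    (0 : ℚ)).and (Filter.eventually_gt_atTop 0)).exists
  have := h n hn0
  rw [← heval] at this
  simp only [Function.comp_apply, Polynomial.eval_sub, Polynomial.eval_pow,
    Polynomial.eval_X] at hn
  linarith

end Growth


/-! ### Cones on which the row minima over flats are fixed entries -/

section Selections

variable {d : ℕ} {Δ : Fan d} {α : Type*} [Fintype α] {M : Matroid α}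

/-- A choice of an element of each nonempty flat for each ray. -/
abbrev Selection (Δ : Fan d) (M : Matroid α) : Type _ :=
  {s : Δ.rays → NonemptyFlat M → α // ∀ ρ F, s ρ F ∈ F.1}

noncomputable instance : Fintype (Selection Δ M) := Fintype.ofFinite _

open Classical in
/-- The inequalities which say that the selected entries are minimal among the entries in the same
row and the same flat. -/
noncomputable def Selection.ineqs (s : Selection Δ M) : Finset (Δ.rays × α → ℤ) :=
  (Finset.univ.filter fun t : Δ.rays × NonemptyFlat M × α => t.2.2 ∈ t.2.1.1).image fun t =>
    Pi.single (t.1, t.2.2) 1 - Pi.single (t.1, s.1 t.1 t.2.1) 1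

theorem Selection.mem_ineqCone (s : Selection Δ M) (x : Δ.rays × α → ℝ) :
    x ∈ ineqCone s.ineqs ↔ ∀ ρ F, ∀ e ∈ F.1, x (ρ, s.1 ρ F) ≤ x (ρ, e) := by
  classical
  have hval : ∀ i j : Δ.rays × α, toReal (Pi.single i 1 - Pi.single j 1) ⬝ᵥ x = x i - x j := by
    intro i j
    have : toReal (Pi.single i 1 - Pi.single j 1 : Δ.rays × α → ℤ) =
        Pi.single i 1 - Pi.single j 1 := by
      funext k
      simp [toReal, Pi.single_apply]
    rw [this, sub_dotProduct, single_dotProduct, single_dotProduct, one_mul, one_mul]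
  constructor
  · intro h ρ F e he
    have := h _ (Finset.mem_image.2 ⟨(ρ, F, e), by simpa using he, rfl⟩)
    rw [hval] at this
    linarith
  · intro h a ha
    obtain ⟨⟨ρ, F, e⟩, ht, rfl⟩ := Finset.mem_image.1 ha
    rw [hval]
    have := h ρ F e (by simpa using ht)
    linarith

theorem Selection.exists_mem_ineqCone (x : Δ.rays × α → ℝ) :
    ∃ s : Selection Δ M, x ∈ ineqCone s.ineqs := by
  have h : ∀ (ρ : Δ.rays) (F : NonemptyFlat M), ∃ e ∈ F.1, ∀ e' ∈ F.1, x (ρ, e) ≤ x (ρ, e') :=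
    fun ρ F => Set.exists_min_image F.1 (fun e => x (ρ, e)) (Set.toFinite _) F.2.2
  choose s hs hs' using h
  exact ⟨⟨s, hs⟩, (Selection.mem_ineqCone _ _).2 hs'⟩

end Selections

theorem Fan.Charts.nonempty_rays {d : ℕ} {Δ : Fan d} (C : Δ.Charts) (hc : Δ.IsComplete)
    (hd : d ≠ 0) : Nonempty Δ.rays := by
  obtain ⟨σ, hσ⟩ : ∃ σ : Δ.cones, (1 : Fin d → ℝ) ∈ σ.1 := by simpa using hc 1
  by_contra hne
  rw [C.cone_eq σ, mem_basisCone] at hσ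
  have h0 : (1 : Fin d → ℝ) = 0 := ext_rcoord (C.basis σ) fun i => by
    rw [(hσ i).2 fun hi => hne ⟨_, C.basis_mem_rays hi⟩, map_zero]
  exact one_ne_zero (congrFun h0 ⟨0, Nat.pos_of_ne_zero hd⟩)

end TropBundle

theorem corollary6p9 (d : ℕ) (Δ : Fan d) (hsmooth : Δ.IsSmooth) (hcomplete : Δ.IsComplete)
    {α : Type*} [Fintype α] [Nonempty α] (M : Matroid α) (hE : M.E = Set.univ)
    [M.Loopless] :
    (∀ D ∈ ampleDiagrams Δ M, {u : Fin d → ℤ | h0 M D (toReal u) ≠ 0}.Finite) ∧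
    IsPiecewisePolynomialOn {x : Δ.rays × α → ℤ | ofEntries x ∈ ampleDiagrams Δ M}
      (fun x => totalSections M (ofEntries x)) d := by
  classical
  obtain ⟨C⟩ := hsmooth.nonempty_charts
  refine ⟨fun D _ => finite_h0_ne_zero C hcomplete, ?_⟩
  obtain ⟨c, hsum⟩ := exists_totalSections_eq_sum (M := M) C hcomplete hE
  obtain ⟨p, hpdeg, hp⟩ := C.exists_polynomial_ncard hcomplete
  refine ⟨Finset.univ.image fun s : Selection Δ M => s.ineqs, fun x => ?_, fun A hA => ?_⟩
  · obtain ⟨s, hs⟩ := Selection.exists_mem_ineqCone (M := M) x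
    exact ⟨_, Finset.mem_image_of_mem _ (Finset.mem_univ s), hs⟩
  obtain ⟨s, -, rfl⟩ := Finset.mem_image.1 hA
  have hflat : ∀ x : Δ.rays × α → ℤ, toReal x ∈ ineqCone s.ineqs → ∀ F : NonemptyFlat M,
      flatPolyhedron (ofEntries x) F.1 =
        Fan.supportPolyhedron fun ρ => ((x (ρ, s.1 ρ F) : ℤ) : ℝ) := fun x hx F =>
    flatPolyhedron_eq (D := ofEntries x) (fun ρ => s.2 ρ F) fun ρ e he =>
      (s.mem_ineqCone _).1 hx ρ F e he
  set P : MvPolynomial (Δ.rays × α) ℚ := ∑ F : NonemptyFlat M,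
    MvPolynomial.C (c F) * MvPolynomial.rename (fun ρ => (ρ, s.1 ρ F)) p with hP
  have hPdeg : P.totalDegree ≤ d := by
    refine MvPolynomial.totalDegree_finsetSum_le fun F _ => ?_
    refine (MvPolynomial.totalDegree_mul _ _).trans ?_
    rw [MvPolynomial.totalDegree_C, zero_add]
    exact (MvPolynomial.totalDegree_rename_le _ _).trans hpdeg
  have hPeval : ∀ x : Δ.rays × α → ℤ, ofEntries x ∈ ampleDiagrams Δ M →
      toReal x ∈ ineqCone s.ineqs →
      (totalSections M (ofEntries x) : ℚ) = MvPolynomial.eval (fun i => (x i : ℚ)) P := by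
    intro x hx hxs
    rw [hsum _ hx.1.1, hP, map_sum]
    refine Finset.sum_congr rfl fun F _ => ?_
    have hfan := hx.2 F.1 F.2.1 F.2.2
    rw [hflat x hxs F] at hfan
    rw [hflat x hxs F, hp _ hfan, map_mul, MvPolynomial.eval_C, MvPolynomial.eval_rename]
    rfl
  -- The degree must be exactly `d` on every cone. A cone with an integral ample matrix gets it from
  -- growth along the ray through that matrix; on a cone without one, any polynomial of degree `d`
  -- will do.
  by_cases hex : ∃ x : Δ.rays × α → ℤ, ofEntries x ∈ ampleDiagrams Δ M ∧
      toReal x ∈ ineqCone s.ineqs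
  · refine ⟨P, le_antisymm hPdeg ?_, hPeval⟩
    obtain ⟨x, hx, hxs⟩ := hex
    let e₀ : α := Classical.arbitrary α
    -- One nonempty flat suffices for the lower bound on the number of sections.
    let F : NonemptyFlat M := ⟨M.closure {e₀}, M.isFlat_closure _,
      e₀, M.mem_closure_of_mem' rfl (by simp [hE])⟩
    have hfan := hx.2 F.1 F.2.1 F.2.2
    rw [hflat x hxs F] at hfan
    obtain ⟨K, hK0, hK⟩ := C.exists_pow_le_ncard hcomplete hfan
    refine le_totalDegree_of_pow_le P (fun i => (K : ℚ) * x i) fun n hn => ?_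
    set z : Δ.rays × α → ℤ := fun i => ((n * K : ℕ) : ℤ) * x i with hz
    have hpos : (0 : ℝ) < ((n * K : ℕ) : ℝ) := by exact_mod_cast Nat.mul_pos hn hK0
    have hzx : ofEntries z = ((n * K : ℕ) : ℝ) • ofEntries x := by
      ext ρ e
      simp [ofEntries, hz]
    have hzamp : ofEntries z ∈ ampleDiagrams Δ M := hzx ▸ smul_mem_ampleDiagrams hx hpos
    have hzs : toReal z ∈ ineqCone s.ineqs := by
      rw [s.mem_ineqCone] at hxs ⊢
      intro ρ G e he
      have := mul_le_mul_of_nonneg_left (hxs ρ G e he) hpos.le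
      simpa [toReal, hz] using this
    have h1 := (hK n).trans (?_ : _ ≤ totalSections M (ofEntries z))
    · have h2 := hPeval z hzamp hzs
      have h3 : MvPolynomial.eval (fun i => (n : ℚ) * ((K : ℚ) * x i)) P =
          MvPolynomial.eval (fun i => (z i : ℚ)) P := by
        congr 2
        funext i
        simp [hz, mul_assoc]
      rw [h3, ← h2]
      exact_mod_cast h1
    · refine le_trans (le_of_eq ?_) (ncard_le_totalSections C hcomplete hE F.2.2)
      rw [hflat z hzs F]
      simp [hz]
  · push Not at hex
    by_cases hd : d = 0
    · exact ⟨0, by simp [hd], fun x hx hxs => (hex x hx hxs).elim⟩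
    · obtain ⟨ρ⟩ := C.nonempty_rays hcomplete hd
      exact ⟨MvPolynomial.X (ρ, Classical.arbitrary α) ^ d, MvPolynomial.totalDegree_X_pow _ _,
        fun x hx hxs => (hex x hx hxs).elim⟩
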